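/- Let $d\ge 1$. A cube is a half-open cube $\prod_{i=1}^d[a_i,a_i+\ell)$, $\ell>0$, in $\mathbb{R}^d$ with sides parallel to the axes, and it is dyadic if $\ell=2^{k}$ and $a\in 2^{k}\mathbb{Z}^d$ for some $k\in\mathbb{Z}$. Write $|E|$ for Lebesgue measure and $\langle f\rangle_Q=\frac1{|Q|}\int_Q f$. A family $\mathcal{S}$ of cubes is $\eta$-sparse if there are measurable sets $E_Q\subset Q$, $Q\in\mathcal{S}$, pairwise disjoint, with $|E_Q|\ge\eta|Q|$. A Dini modulus of continuity is a continuous non-decreasing function $\omega\colon[0,1]\to[0,\infty)$ with $\int_0^1\omega(t)\frac{dt}{t}<\infty$. A Calderón–Zygmund operator with Dini-smooth kernel is a bounded linear operator $T$ on the complex space $L^2(\mathbb{R}^d)$ for which there are a function $K(x,y)\in\mathbb{C}$, $x\ne y$, a constant $c_K$ and a Dini modulus of continuity $\omega$ such that (a) for every bounded, compactly supported measurable $f$, $Tf(x)=\int_{\mathbb{R}^d}K(x,y)f(y)\,dy$ for almost every $x\notin\operatorname{supp} f$; (b) $|K(x,y)|\le c_K|x-y|^{-d}$ for $x\ne y$;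 (c) $|K(x,y)-K(x',y)|+|K(y,x)-K(y,x')|\le \frac{c_K}{|x-y|^{d}}\,\omega\!\left(\frac{|x-x'|}{|x-y|}\right)$ whenever $x\neq y$ and $2|x-x'|\le|x-y|$. Theorem. There is $\eta_0=\eta_0(d)\in(0,1)$ such that the following holds for every $\eta\in(0,\eta_0)$. For every dyadic cube $Q_0$ and every pair $(f_1,f_2)$ of nonnegative, bounded, measurable functions supported on $Q_0$, there is an $\eta$-sparse family $\mathcal{S}$ of cubes, depending on $(f_1,f_2)$ (and on $d$, $\eta$, $Q_0$) but not on $T$, such that $\sum_{Q\in\mathcal{S}}\langle f_1\rangle_Q\langle f_2\rangle_Q|Q|<\infty$ and, for every Calderón–Zygmund operator $T$ with Dini-smooth kernel, \[ |\langle Tf_1,f_2\rangle|\le C\sum_{Q\in\mathcal{S}}\langle f_1\rangle_Q\langle f_2\rangle_Q\,|Q|, \] where $C$ depends only on $d$, $\eta$, $\|T\|_{L^2\to L^2}$, $c_K$ and $\int_0^1\omega(t)\frac{dt}{t}$; in particular $C$ does not depend on $Q_0$, $f_1$, $f_2$. -/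

import Mathlib

open MeasureTheory
open scoped ENNReal

/-- Euclidean space `ℝ^d`. -/
abbrev RSpace (d : ℕ) : Type := EuclideanSpace ℝ (Fin d)

/-- The complex Hilbert space `L²(ℝ^d)`. -/
abbrev L2Space (d : ℕ) : Type := Lp ℂ 2 (volume : Measure (RSpace d))

/-- The half-open cube with lower corner `a`, side length `l` and sides parallel to the axes. -/
def halfOpenCube {d : ℕ} (a : RSpace d) (l : ℝ) : Set (RSpace d) :=
  {x | ∀ i, a i ≤ x i ∧ x i < a i + l}

/-- `Q` is a (nondegenerate, half-open) cube with sides parallel to the coordinate axes. -/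
def IsCube {d : ℕ} (Q : Set (RSpace d)) : Prop :=
  ∃ (a : RSpace d) (l : ℝ), 0 < l ∧ Q = halfOpenCube a l

/-- `Q` belongs to the standard dyadic system: `Q = 2^k (m + [0,1)^d)`, `k ∈ ℤ`, `m ∈ ℤ^d`. -/
def IsDyadicCube {d : ℕ} (Q : Set (RSpace d)) : Prop :=
  ∃ (k : ℤ) (m : Fin d → ℤ),
    Q = halfOpenCube (WithLp.toLp 2 (fun i => (2 : ℝ) ^ k * (m i : ℝ))) ((2 : ℝ) ^ k)

/-- `η`-sparse families of measurable sets in a measure space. -/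
def IsSparse {Ω : Type*} [MeasurableSpace Ω] (μ : Measure Ω) (η : ℝ) (S : Set (Set Ω)) : Prop :=
  (∀ Q ∈ S, MeasurableSet Q) ∧
  ∃ E : Set Ω → Set Ω,
    (∀ Q ∈ S, MeasurableSet (E Q) ∧ E Q ⊆ Q ∧ ENNReal.ofReal η * μ Q ≤ μ (E Q)) ∧
    (∀ Q ∈ S, ∀ R ∈ S, Q ≠ R → Disjoint (E Q) (E R))

/-- A modulus of continuity on `[0,1]` satisfying the Dini condition. Only the values of `ω`
on `[0,1]` matter. -/
structure IsDiniModulus (ω : ℝ → ℝ) : Prop where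
  nonneg : ∀ t ∈ Set.Icc (0 : ℝ) 1, 0 ≤ ω t
  continuousOn : ContinuousOn ω (Set.Icc 0 1)
  monotoneOn : MonotoneOn ω (Set.Icc 0 1)
  dini : IntegrableOn (fun t => ω t / t) (Set.Ioc 0 1) volume

/-- `T`, a bounded operator on `L²(ℝ^d)`, is a Calderón–Zygmund operator with kernel `K`, whose
size and smoothness estimates hold with constant `c` and with the Dini modulus `ω`.
The values of `K` on the diagonal play no role. -/
structure IsDiniCZO {d : ℕ} (T : L2Space d →L[ℂ] L2Space d) (K : RSpace d → RSpace d → ℂ)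
    (c : ℝ) (ω : ℝ → ℝ) : Prop where
  modulus : IsDiniModulus ω
  /-- `Tf(x) = ∫ K(x,y) f(y) dy` off the support of `f`, for bounded `f` of compact support. -/
  representation : ∀ (f : RSpace d → ℂ) (hf : MemLp f 2 volume),
    MemLp f ∞ volume → HasCompactSupport f →
      ∀ᵐ x ∂(volume : Measure (RSpace d)), x ∉ tsupport f →
        T (hf.toLp f) x = ∫ y, K x y * f y
  size : ∀ x y, x ≠ y → ‖K x y‖ ≤ c / ‖x - y‖ ^ d
  smooth : ∀ x x' y, x ≠ y → 2 * ‖x - x'‖ ≤ ‖x - y‖ →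
    ‖K x y - K x' y‖ + ‖K y x - K y x'‖ ≤ c / ‖x - y‖ ^ d * ω (‖x - x'‖ / ‖x - y‖)

theorem IsDyadicCube.isBounded {d : ℕ} {Q : Set (RSpace d)} (hQ : IsDyadicCube Q) :
    Bornology.IsBounded Q := by
  obtain ⟨k, m, rfl⟩ := hQ
  set a : Fin d → ℝ := fun i => (2 : ℝ) ^ k * (m i : ℝ) with ha
  have h : Bornology.IsBounded (Set.Icc a (fun i => a i + (2 : ℝ) ^ k)) :=
    Metric.isBounded_Icc _ _
  refine ((PiLp.lipschitzWith_toLp 2 (fun _ : Fin d => ℝ)).isBounded_image h).subset ?_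
  intro x hx
  exact ⟨WithLp.ofLp x, ⟨fun i => (hx i).1, fun i => (hx i).2.le⟩, rfl⟩

/-- A bounded function supported on a dyadic cube, seen as a complex function, is in `L²`. -/
theorem memLp_two_of_support_subset {d : ℕ} {Q : Set (RSpace d)} (hQ : IsDyadicCube Q)
    {f : RSpace d → ℝ} (hf : MemLp f ∞ volume) (hs : Function.support f ⊆ Q) :
    MemLp (fun x => (f x : ℂ)) 2 volume := by
  have h2 : MemLp f 2 volume :=
    hf.mono_exponent_of_measure_support_ne_top
      (s := Q) (fun x hx => by
        by_contra h
        exact hx (hs h)) hQ.isBounded.measure_lt_top.ne le_top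
  exact h2.ofReal

/-- The function `f` as an element of `L²(ℝ^d)`. -/
noncomputable def toL2 {d : ℕ} {Q : Set (RSpace d)} (hQ : IsDyadicCube Q)
    {f : RSpace d → ℝ} (hf : MemLp f ∞ volume) (hs : Function.support f ⊆ Q) : L2Space d :=
  (memLp_two_of_support_subset hQ hf hs).toLp (fun x => (f x : ℂ))

/-!
The bilinear form `(u, v) ↦ ∫ (T u) v` is bounded by a recursion over stopping cubes which only
sees the averages of `f₁` and `f₂`, so that the resulting sparse family does not depend on `T`.

Fix a dyadic cube `q` and its concentric enlargement `q.hat`. The exceptional set `Ω` is where the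
uncentred maximal function of `f₁` or of `f₂`, restricted to `q.hat`, exceeds a large multiple of
the corresponding average. By the weak type bound `mul_volume_maximalSet_le`, `Ω` has at most
half the measure of `q`. The stopping cubes are the Whitney cubes `P` of `Ω` inside `q`. Subtracting
from `f₁` and `f₂` their means on the Whitney cubes gives the Calderón–Zygmund decompositions
`fᵢ = gᵢ + ∑ bᵢ`, in which both good parts are bounded by averages.

The interactions of `f₁` on a Whitney cube `P` with `f₂` on the Whitney cubes near `P` cannot be
estimated and are passed on to the recursion. Whitney cubes near each other have comparable sizes,
so the second factor lives in `P.hat`. In what is left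
(`IsSeparatedFamily.bilin_sub_sum_eq`), the good parts are paired with each other and are handled by
the `L²` bound of `T`, while every bad part is paired with a function supported far from its cube.
Its mean value zero and the smoothness of the kernel then reduce the pairing to a tail integral,
which the Dini condition and the control of all averages at larger scales bound by
`∫ ω(t) dt / t` (`IsDiniModulus.lintegral_tail_le`). Only `L¹` norms of the bad parts enter.

Whitney families are infinite, but the algebra is done for finitely many cubes
(`IsSeparatedFamily.norm_bilin_sub_sum_le`). For that, the recursion is set up for the supremum
`localForm` of the form over all restrictions of `f₁` to subsets of `q` and of `f₂` to subsets of
`q.hat`: the points of `Ω` outside the finitely many cubes can be dropped up to an arbitrarily small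
error, as `f₁` and `f₂` are bounded. The result is `localForm_le_add_tsum`. Iterating it, the
remainder tends to zero because the stopping cubes halve the total measure
(`le_tsum_descendants`). For the same reason, the cubes `q` produced by the iteration have disjoint
subsets `core` of at least half their measure, so the enlarged cubes `q.hat` form a sparse family.
-/

/-! ### Test functions and the bilinear form of an operator -/

/-- Test functions: essentially bounded functions with compact support. -/
structure IsTest {d : ℕ} (u : RSpace d → ℂ) : Prop where
  memLp_top : MemLp u ∞ volume
  hasCompactSupport : HasCompactSupport u

namespace IsTest

variable {d : ℕ} {u v : RSpace d → ℂ}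

theorem of_support_subset {X : Set (RSpace d)} (hu : MemLp u ∞ volume)
    (hX : Bornology.IsBounded X) (hs : Function.support u ⊆ X) : IsTest u :=
  ⟨hu, Metric.isCompact_of_isClosed_isBounded (isClosed_tsupport u)
    ((hX.subset hs).closure)⟩

theorem measure_tsupport_lt_top (hu : IsTest u) : volume (tsupport u) < ∞ :=
  hu.hasCompactSupport.measure_lt_top

theorem memLp (hu : IsTest u) (p : ℝ≥0∞) : MemLp u p volume :=
  hu.memLp_top.mono_exponent_of_measure_support_ne_top (s := tsupport u)
    (fun _ hx => image_eq_zero_of_notMem_tsupport hx) hu.measure_tsupport_lt_top.ne le_top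

theorem integrable (hu : IsTest u) : Integrable u volume :=
  memLp_one_iff_integrable.1 (hu.memLp 1)

theorem add (hu : IsTest u) (hv : IsTest v) : IsTest (u + v) :=
  ⟨hu.memLp_top.add hv.memLp_top, hu.hasCompactSupport.add hv.hasCompactSupport⟩

theorem neg (hu : IsTest u) : IsTest (-u) :=
  ⟨hu.memLp_top.neg, hu.hasCompactSupport.neg⟩

theorem sub (hu : IsTest u) (hv : IsTest v) : IsTest (u - v) := by
  rw [sub_eq_add_neg]
  exact hu.add hv.neg

theorem zero : IsTest (0 : RSpace d → ℂ) :=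
  ⟨MemLp.zero, HasCompactSupport.zero⟩

theorem sum {ι : Type*} (F : Finset ι) {w : ι → RSpace d → ℂ} (hw : ∀ i ∈ F, IsTest (w i)) :
    IsTest (∑ i ∈ F, w i) := by
  classical
  induction F using Finset.induction_on with
  | empty => simpa using zero
  | insert a s ha ih =>
    rw [Finset.sum_insert ha]
    exact (hw a (by simp)).add (ih fun i hi => hw i (by simp [hi]))

theorem indicator (hu : IsTest u) {E : Set (RSpace d)} (hE : MeasurableSet E) :
    IsTest (E.indicator u) :=
  ⟨hu.memLp_top.indicator hE,
    hu.hasCompactSupport.mono ((Set.support_indicator).trans_subset Set.inter_subset_right)⟩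

theorem indicator_const {E : Set (RSpace d)} (hE : MeasurableSet E) (hb : Bornology.IsBounded E)
    (a : ℂ) : IsTest (E.indicator fun _ => a) :=
  of_support_subset ((memLp_top_const a).indicator hE) hb Set.support_indicator_subset

end IsTest

/-- The bilinear form `(u, v) ↦ ∫ (T u) v` of an operator `T` on `L²`, for functions `u` in `L²`
(with value `0` for other `u`). -/
noncomputable def bilin {d : ℕ} (T : L2Space d →L[ℂ] L2Space d) (u v : RSpace d → ℂ) : ℂ :=
  open Classical in
  if h : MemLp u 2 volume then ∫ x, T (h.toLp u) x * v x else 0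

section bilin

variable {d : ℕ} (T : L2Space d →L[ℂ] L2Space d) {u u' v v' : RSpace d → ℂ}

theorem ae_norm_indicator_le {f : RSpace d → ℂ} {a : ℝ} (E : Set (RSpace d)) (h : ∀ᵐ x, ‖f x‖ ≤ a) :
    ∀ᵐ x, ‖E.indicator f x‖ ≤ a := by
  filter_upwards [h] with x hx
  exact (norm_indicator_le_norm_self _ _).trans hx

theorem bilin_eq (hu : MemLp u 2 volume) : bilin T u v = ∫ x, T (hu.toLp u) x * v x := by
  rw [bilin, dif_pos hu]

theorem integrable_bilin (f : L2Space d) (hv : MemLp v 2 volume) :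
    Integrable (fun x => T f x * v x) volume := (Lp.memLp (T f)).integrable_mul hv

theorem bilin_add_left (hu : IsTest u) (hu' : IsTest u') (hv : IsTest v) :
    bilin T (u + u') v = bilin T u v + bilin T u' v := by
  rw [bilin_eq T (hu.memLp 2), bilin_eq T (hu'.memLp 2), bilin_eq T ((hu.add hu').memLp 2),
    ← integral_add (integrable_bilin T _ (hv.memLp 2)) (integrable_bilin T _ (hv.memLp 2))]
  apply integral_congr_ae
  have : ((hu.add hu').memLp 2).toLp (u + u') = (hu.memLp 2).toLp u + (hu'.memLp 2).toLp u' := rfl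
  rw [this, map_add]
  filter_upwards [Lp.coeFn_add (T ((hu.memLp 2).toLp u)) (T ((hu'.memLp 2).toLp u'))] with x hx
  rw [hx, Pi.add_apply, add_mul]

theorem bilin_add_right (hu : IsTest u) (hv : IsTest v) (hv' : IsTest v') :
    bilin T u (v + v') = bilin T u v + bilin T u v' := by
  simp only [bilin_eq T (hu.memLp 2), Pi.add_apply, mul_add]
  exact integral_add (integrable_bilin T _ (hv.memLp 2)) (integrable_bilin T _ (hv'.memLp 2))

theorem bilin_zero_right (hu : IsTest u) : bilin T u 0 = 0 := by
  simp [bilin_eq T (hu.memLp 2)]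

theorem bilin_zero_left (hv : IsTest v) : bilin T 0 v = 0 := by
  simpa using bilin_add_left T (u := 0) (u' := 0) IsTest.zero IsTest.zero hv

theorem bilin_sum_left {ι : Type*} (F : Finset ι) {w : ι → RSpace d → ℂ}
    (hw : ∀ i ∈ F, IsTest (w i)) (hv : IsTest v) :
    bilin T (∑ i ∈ F, w i) v = ∑ i ∈ F, bilin T (w i) v := by
  classical
  induction F using Finset.induction_on with
  | empty => simpa using bilin_zero_left T hv
  | insert a s ha ih =>
    rw [Finset.sum_insert ha, Finset.sum_insert ha,
      bilin_add_left T (hw a (by simp)) (IsTest.sum s fun i hi => hw i (by simp [hi])) hv,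
      ih fun i hi => hw i (by simp [hi])]

theorem bilin_sum_right {ι : Type*} (F : Finset ι) {w : ι → RSpace d → ℂ}
    (hu : IsTest u) (hw : ∀ i ∈ F, IsTest (w i)) :
    bilin T u (∑ i ∈ F, w i) = ∑ i ∈ F, bilin T u (w i) := by
  classical
  induction F using Finset.induction_on with
  | empty => simpa using bilin_zero_right T hu
  | insert a s ha ih =>
    rw [Finset.sum_insert ha, Finset.sum_insert ha,
      bilin_add_right T hu (hw a (by simp)) (IsTest.sum s fun i hi => hw i (by simp [hi])),
      ih fun i hi => hw i (by simp [hi])]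

theorem enorm_bilin_le (hu : IsTest u) (hv : IsTest v) :
    ‖bilin T u v‖ₑ ≤ ‖T‖ₑ * eLpNorm u 2 volume * eLpNorm v 2 volume := by
  rw [bilin_eq T (hu.memLp 2)]
  refine (enorm_integral_le_lintegral_enorm _).trans ?_
  rw [← eLpNorm_one_eq_lintegral_enorm]
  refine (eLpNorm_smul_le_mul_eLpNorm (p := 2) (q := 2) (r := 1) (hv.memLp 2).1
    (Lp.memLp (T ((hu.memLp 2).toLp u))).1).trans ?_
  gcongr
  rw [← Lp.enorm_def]
  refine (ContinuousLinearMap.le_opENorm T _).trans ?_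
  rw [Lp.enorm_def, eLpNorm_congr_ae (MemLp.coeFn_toLp _)]

theorem eLpNorm_two_le {α : ℝ} {X : Set (RSpace d)}
    (hb : ∀ᵐ x, ‖u x‖ ≤ α) (hs : Function.support u ⊆ X) :
    eLpNorm u 2 volume ≤ volume X ^ (1 / 2 : ℝ) * ENNReal.ofReal α := by
  rw [← eLpNorm_restrict_eq_of_support_subset hs]
  refine (eLpNorm_le_of_ae_bound (ae_restrict_of_ae hb)).trans ?_
  simp

/-- The `L²` bound of the form, for bounded functions supported on given sets. -/
theorem enorm_bilin_le_of_support (hu : IsTest u) (hv : IsTest v) {a b : ℝ}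
    (ha : ∀ᵐ x, ‖u x‖ ≤ a) (hb : ∀ᵐ x, ‖v x‖ ≤ b) {X Y : Set (RSpace d)}
    (hX : Function.support u ⊆ X) (hY : Function.support v ⊆ Y) :
    ‖bilin T u v‖ₑ ≤ ‖T‖ₑ * (volume X ^ (1 / 2 : ℝ) * ENNReal.ofReal a) *
      (volume Y ^ (1 / 2 : ℝ) * ENNReal.ofReal b) := by
  refine (enorm_bilin_le T hu hv).trans ?_
  gcongr
  · exact eLpNorm_two_le ha hX
  · exact eLpNorm_two_le hb hY

theorem norm_bilin_le {α β : ℝ} {X Y : Set (RSpace d)} (hu : IsTest u) (hv : IsTest v)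
    (hα : 0 ≤ α) (hβ : 0 ≤ β) (hX : volume X ≠ ∞) (hY : volume Y ≠ ∞)
    (hbu : ∀ᵐ x, ‖u x‖ ≤ α) (hbv : ∀ᵐ x, ‖v x‖ ≤ β)
    (hsu : Function.support u ⊆ X) (hsv : Function.support v ⊆ Y) :
    ‖bilin T u v‖ ≤ ‖T‖ * α * β * √(volume.real X * volume.real Y) := by
  have h : ‖bilin T u v‖ₑ ≤ ‖T‖ₑ * (volume X ^ (1 / 2 : ℝ) * ENNReal.ofReal α) *
      (volume Y ^ (1 / 2 : ℝ) * ENNReal.ofReal β) :=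
    enorm_bilin_le_of_support T hu hv hbu hbv hsu hsv
  have h2 := ENNReal.toReal_mono (by finiteness) h
  simp only [toReal_enorm, ENNReal.toReal_mul, ENNReal.toReal_ofReal hα,
    ENNReal.toReal_ofReal hβ, ← ENNReal.toReal_rpow] at h2
  rw [Real.sqrt_mul measureReal_nonneg, Real.sqrt_eq_rpow, Real.sqrt_eq_rpow]
  refine h2.trans (le_of_eq ?_)
  simp only [measureReal_def]
  ring

end bilin

/-! ### Kernel estimates -/

namespace IsDiniModulus

variable {ω : ℝ → ℝ}

theorem pow_mem_Icc (j : ℕ) : (2⁻¹ : ℝ) ^ j ∈ Set.Icc (0 : ℝ) 1 :=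
  ⟨by positivity, pow_le_one₀ (by norm_num) (by norm_num)⟩

/-- A Dini modulus is summable along the powers of `1/2`, with sum at most twice its Dini
integral. -/
theorem tsum_le (hω : IsDiniModulus ω) :
    ∑' j : ℕ, ENNReal.ofReal (ω (2⁻¹ ^ (j + 1))) ≤
      ENNReal.ofReal (2 * ∫ t in Set.Ioc (0 : ℝ) 1, ω t / t) := by
  set s : ℕ → Set ℝ := fun j => Set.Ioc (2⁻¹ ^ (j + 1)) (2⁻¹ ^ j) with hs
  have hanti : Antitone fun j : ℕ => (2⁻¹ : ℝ) ^ j :=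
    pow_right_anti₀ (by norm_num) (by norm_num)
  have hdisj : Pairwise (Function.onFun Disjoint s) := by
    intro i j hij
    have key : ∀ i j : ℕ, i < j → Disjoint (s i) (s j) := by
      intro i j hij
      rw [Set.disjoint_left]
      rintro x ⟨hx, -⟩ ⟨-, hx'⟩
      exact absurd (hx'.trans (hanti (Nat.succ_le_of_lt hij))) (not_le.2 hx)
    rcases lt_or_gt_of_ne hij with h | h
    · exact key i j h
    · exact (key j i h).symm
  have hsub : (⋃ j, s j) ⊆ Set.Ioc 0 1 := by
    refine Set.iUnion_subset fun j x hx => ⟨lt_trans (by positivity) hx.1, hx.2.trans ?_⟩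
    exact (pow_mem_Icc j).2
  have hpos : 0 ≤ᵐ[volume.restrict (Set.Ioc (0 : ℝ) 1)] fun t => ω t / t := by
    filter_upwards [ae_restrict_mem measurableSet_Ioc] with t ht
    exact div_nonneg (hω.nonneg t ⟨ht.1.le, ht.2⟩) ht.1.le
  rw [ENNReal.ofReal_mul (by norm_num), ofReal_integral_eq_lintegral_ofReal hω.dini hpos]
  refine le_trans ?_ (mul_le_mul_right (lintegral_mono_set hsub) _)
  rw [lintegral_iUnion (fun j => measurableSet_Ioc) hdisj, ← ENNReal.tsum_mul_left]
  refine ENNReal.tsum_le_tsum fun j => ?_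
  have hbd : ∫⁻ _ in s j, ENNReal.ofReal (ω (2⁻¹ ^ (j + 1)) / 2⁻¹ ^ j) ≤
      ∫⁻ t in s j, ENNReal.ofReal (ω t / t) := by
    refine setLIntegral_mono' measurableSet_Ioc fun t ht => ENNReal.ofReal_le_ofReal ?_
    have h0 : (0 : ℝ) < 2⁻¹ ^ (j + 1) := by positivity
    have ht1 : t ≤ 1 := ht.2.trans (pow_mem_Icc j).2
    have ht0 : 0 < t := h0.trans ht.1
    have hm := hω.monotoneOn (pow_mem_Icc (j + 1)) ⟨ht0.le, ht1⟩ ht.1.le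
    have h1 := hω.nonneg t ⟨ht0.le, ht1⟩
    exact div_le_div₀ h1 hm ht0 ht.2
  rw [setLIntegral_const, Real.volume_Ioc] at hbd
  refine le_trans (le_of_eq ?_) (mul_le_mul_right hbd _)
  have h1 := hω.nonneg _ (pow_mem_Icc (j + 1))
  rw [← ENNReal.ofReal_mul (by positivity), ← ENNReal.ofReal_mul (by positivity)]
  congr 1
  rw [pow_succ]
  field_simp
  ring

theorem exists_small (hω : IsDiniModulus ω) {ε : ℝ} (hε : 0 < ε) :
    ∃ δ > 0, ∀ t, 0 ≤ t → t ≤ δ → ω t < ε := by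
  have h := ENNReal.tendsto_atTop_zero_of_tsum_ne_top
    (ne_top_of_le_ne_top ENNReal.ofReal_ne_top hω.tsum_le)
  obtain ⟨j, hj⟩ := ((tendsto_order.1 h).2 (ENNReal.ofReal ε) (by simpa using hε)).exists
  refine ⟨2⁻¹ ^ (j + 1), by positivity, fun t h0 ht => ?_⟩
  refine (hω.monotoneOn ⟨h0, ht.trans (pow_mem_Icc _).2⟩ (pow_mem_Icc _) ht).trans_lt ?_
  exact (ENNReal.ofReal_lt_ofReal_iff hε).1 hj

/-- The tail integral `∫ |h(x)| |x - p|^{-d} ω(ρ / (2|x - p|)) dx` outside the ball of radius `ρ`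
is controlled by the averages of `|h|` over the larger balls centred at `p`. -/
theorem lintegral_tail_le {d : ℕ} (hω : IsDiniModulus ω) {h : RSpace d → ℂ}
    {p : RSpace d} {c ρ β : ℝ} (hc : 0 ≤ c) (hρ : 0 < ρ) (hβ : 0 ≤ β)
    (hbd : ∀ r, ρ ≤ r → ∫⁻ x in Metric.ball p r, ‖h x‖ₑ ≤ ENNReal.ofReal (β * r ^ d))
    (hs : ∀ x, h x ≠ 0 → ρ ≤ ‖x - p‖) :
    ∫⁻ x, ‖h x‖ₑ * ENNReal.ofReal (c / ‖x - p‖ ^ d * ω (ρ / 2 / ‖x - p‖)) ≤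
      ENNReal.ofReal (c * β * 2 ^ (d + 1) * ∫ t in Set.Ioc (0 : ℝ) 1, ω t / t) := by
  set A : ℕ → Set (RSpace d) := fun j => {x | 2 ^ j * ρ ≤ ‖x - p‖ ∧ ‖x - p‖ < 2 ^ (j + 1) * ρ}
  have hA : ∀ j, MeasurableSet (A j) := fun j => by
    refine MeasurableSet.inter (s₁ := {x : RSpace d | 2 ^ j * ρ ≤ ‖x - p‖})
      (s₂ := {x : RSpace d | ‖x - p‖ < 2 ^ (j + 1) * ρ}) ?_ ?_
    · exact measurableSet_le measurable_const (by fun_prop)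
    · exact measurableSet_lt (by fun_prop) measurable_const
  set f : RSpace d → ℝ≥0∞ := fun x =>
    ‖h x‖ₑ * ENNReal.ofReal (c / ‖x - p‖ ^ d * ω (ρ / 2 / ‖x - p‖)) with hf
  have hfA : f = (⋃ j, A j).indicator f := by
    rw [eq_comm, Set.indicator_eq_self]
    intro x hx
    have hx0 : h x ≠ 0 := by
      intro h0
      simp [hf, h0] at hx
    obtain ⟨n, h1, h2⟩ := exists_nat_pow_near (x := ‖x - p‖ / ρ) (y := 2)
      ((one_le_div hρ).2 (hs x hx0)) (by norm_num)
    exact Set.mem_iUnion.2 ⟨n, (le_div_iff₀ hρ).1 h1, (div_lt_iff₀ hρ).1 h2⟩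
  change ∫⁻ x, f x ≤ _
  rw [hfA, lintegral_indicator (MeasurableSet.iUnion hA)]
  refine (lintegral_iUnion_le _ _).trans ?_
  have hterm : ∀ j, ∫⁻ x in A j, f x ≤
      ENNReal.ofReal (c * β * 2 ^ d) * ENNReal.ofReal (ω (2⁻¹ ^ (j + 1))) := by
    intro j
    have hω0 := hω.nonneg _ (pow_mem_Icc (j + 1))
    calc ∫⁻ x in A j, f x ≤ ∫⁻ x in A j, ‖h x‖ₑ *
          ENNReal.ofReal (c / (2 ^ j * ρ) ^ d * ω (2⁻¹ ^ (j + 1))) := by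
          refine setLIntegral_mono' (hA j) fun x hx => ?_
          have hx1 : 2 ^ j * ρ ≤ ‖x - p‖ := hx.1
          have h0 : 0 < 2 ^ j * ρ := by positivity
          have hx0 : 0 < ‖x - p‖ := h0.trans_le hx1
          have hle : ρ / 2 / ‖x - p‖ ≤ 2⁻¹ ^ (j + 1) := by
            rw [div_le_iff₀ hx0]
            calc ρ / 2 = 2⁻¹ ^ (j + 1) * (2 ^ j * ρ) := by
                  rw [inv_pow, pow_succ]; field_simp
              _ ≤ _ := by gcongr
          refine mul_le_mul_right (ENNReal.ofReal_le_ofReal ?_) _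
          refine mul_le_mul (by gcongr) (hω.monotoneOn ⟨by positivity, hle.trans (pow_mem_Icc _).2⟩
            (pow_mem_Icc _) hle) (hω.nonneg _ ⟨by positivity, hle.trans (pow_mem_Icc _).2⟩)
            (by positivity)
      _ = (∫⁻ x in A j, ‖h x‖ₑ) *
          ENNReal.ofReal (c / (2 ^ j * ρ) ^ d * ω (2⁻¹ ^ (j + 1))) :=
          lintegral_mul_const' _ _ ENNReal.ofReal_ne_top
      _ ≤ ENNReal.ofReal (β * (2 ^ (j + 1) * ρ) ^ d) *
          ENNReal.ofReal (c / (2 ^ j * ρ) ^ d * ω (2⁻¹ ^ (j + 1))) := by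
          gcongr
          refine le_trans (lintegral_mono_set fun x hx => ?_) (hbd _ ?_)
          · simpa [Metric.mem_ball, dist_eq_norm] using hx.2
          · have : (1 : ℝ) ≤ 2 ^ (j + 1) := one_le_pow₀ (by norm_num)
            nlinarith
      _ = _ := by
          rw [← ENNReal.ofReal_mul (by positivity), ← ENNReal.ofReal_mul (by positivity)]
          congr 1
          have h0 : (2 ^ j * ρ) ^ d ≠ 0 := by positivity
          rw [show (2 : ℝ) ^ (j + 1) * ρ = 2 ^ j * ρ * 2 by ring, mul_pow _ (2 : ℝ)]
          field_simp
  refine (ENNReal.tsum_le_tsum hterm).trans ?_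
  rw [ENNReal.tsum_mul_left]
  refine (mul_le_mul_right hω.tsum_le _).trans (le_of_eq ?_)
  rw [← ENNReal.ofReal_mul (by positivity)]
  congr 1
  ring

theorem dini_nonneg (hω : IsDiniModulus ω) : 0 ≤ ∫ t in Set.Ioc (0 : ℝ) 1, ω t / t :=
  setIntegral_nonneg measurableSet_Ioc fun t ht =>
    div_nonneg (hω.nonneg t ⟨ht.1.le, ht.2⟩) ht.1.le

end IsDiniModulus

theorem notMem_tsupport_of_le_norm_sub {d : ℕ} {b : RSpace d → ℂ} {x : RSpace d} {ρ : ℝ}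
    (hρ : 0 < ρ) (hs : ∀ y, b y ≠ 0 → ρ ≤ ‖x - y‖) : x ∉ tsupport b := by
  intro hx
  obtain ⟨y, hy, hxy⟩ := Metric.mem_closure_iff.1 hx ρ hρ
  rw [dist_eq_norm] at hxy
  exact absurd (hs y hy) (not_le.2 hxy)

namespace IsDiniCZO

variable {d : ℕ} {T : L2Space d →L[ℂ] L2Space d} {K : RSpace d → RSpace d → ℂ} {c : ℝ} {ω : ℝ → ℝ}

theorem const_nonneg (hT : IsDiniCZO T K c ω) (hd : 1 ≤ d) : 0 ≤ c := by
  have h := hT.size (EuclideanSpace.single ⟨0, hd⟩ 1) 0 (by simp)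
  have h1 : ‖(EuclideanSpace.single ⟨0, hd⟩ 1 : RSpace d) - 0‖ = 1 := by simp
  rw [h1] at h
  simpa using (norm_nonneg _).trans h

/-- The smoothness of the kernel in either variable, with the modulus evaluated at a quantity that
does not depend on the displaced point `y`. -/
theorem norm_kernel_sub_le (hT : IsDiniCZO T K c ω) (hd : 1 ≤ d) {x p y : RSpace d} {ρ : ℝ}
    (hρ : 0 < ρ) (hy : 2 * ‖p - y‖ ≤ ρ) (hx : ρ ≤ ‖x - p‖) :
    ‖K x y - K x p‖ ≤ c / ‖x - p‖ ^ d * ω (ρ / 2 / ‖x - p‖) ∧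
    ‖K y x - K p x‖ ≤ c / ‖x - p‖ ^ d * ω (ρ / 2 / ‖x - p‖) := by
  have hx0 : 0 < ‖x - p‖ := hρ.trans_le hx
  have hne : p ≠ x := by
    rintro rfl
    simp at hx0
  have h := hT.smooth p y x hne (by rw [norm_sub_rev p x]; exact hy.trans hx)
  have hc := hT.const_nonneg hd
  rw [norm_sub_rev p x] at h
  have h1 : ρ / 2 / ‖x - p‖ ≤ 1 := by
    rw [div_le_one hx0]; linarith
  have h2 : ‖p - y‖ / ‖x - p‖ ≤ ρ / 2 / ‖x - p‖ := by
    gcongr; linarith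
  have hm := hT.modulus.monotoneOn ⟨by positivity, h2.trans h1⟩ ⟨by positivity, h1⟩ h2
  have h3 : c / ‖x - p‖ ^ d * ω (‖p - y‖ / ‖x - p‖) ≤
      c / ‖x - p‖ ^ d * ω (ρ / 2 / ‖x - p‖) := by gcongr
  rw [norm_sub_rev (K x y), norm_sub_rev (K y x)]
  constructor
  · linarith [norm_nonneg (K p x - K y x)]
  · linarith [norm_nonneg (K x p - K x y)]

theorem continuousOn_kernel (hT : IsDiniCZO T K c ω) (hd : 1 ≤ d) (x : RSpace d) :
    ContinuousOn (K x) {x}ᶜ := by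
  intro y hy
  refine ContinuousAt.continuousWithinAt ?_
  have hyx : y ≠ x := hy
  have h0 : 0 < ‖y - x‖ := norm_pos_iff.2 (sub_ne_zero.2 hyx)
  have hc := hT.const_nonneg hd
  rw [Metric.continuousAt_iff]
  intro ε hε
  obtain ⟨δ, hδ, hδω⟩ := hT.modulus.exists_small (ε := ε / (c / ‖y - x‖ ^ d + 1))
    (by positivity)
  refine ⟨min δ (1 / 2) * ‖y - x‖, by positivity, fun {z} hz => ?_⟩
  rw [dist_eq_norm, norm_sub_rev] at hz ⊢
  have hz' : ‖y - z‖ / ‖y - x‖ < min δ (1 / 2) := (div_lt_iff₀ h0).2 hz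
  have hz2 : 2 * ‖y - z‖ ≤ ‖y - x‖ := by
    have := (div_lt_iff₀ h0).1 (hz'.trans_le (min_le_right _ _))
    linarith
  have h := hT.smooth y z x hyx hz2
  have hw := hδω (‖y - z‖ / ‖y - x‖) (by positivity) (hz'.le.trans (min_le_left _ _))
  have hw0 : 0 ≤ ω (‖y - z‖ / ‖y - x‖) := hT.modulus.nonneg _
    ⟨by positivity, (hz'.le.trans (min_le_right _ _)).trans (by norm_num)⟩
  rw [lt_div_iff₀ (by positivity)] at hw
  have : 0 ≤ c / ‖y - x‖ ^ d := by positivity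
  nlinarith [norm_nonneg (K y x - K z x)]

/-- The kernel integral `∫ K(x, y) b(y) dy` converges absolutely for `x` away from the support
of `b`. -/
theorem integrable_kernel_mul (hT : IsDiniCZO T K c ω) (hd : 1 ≤ d) {b : RSpace d → ℂ}
    (hb : Integrable b volume) {x : RSpace d} {ρ : ℝ} (hρ : 0 < ρ)
    (hs : ∀ y, b y ≠ 0 → ρ ≤ ‖x - y‖) : Integrable (fun y => K x y * b y) volume := by
  have hc := hT.const_nonneg hd
  set S : Set (RSpace d) := {y | ρ ≤ ‖x - y‖}
  have hS : MeasurableSet S := measurableSet_le measurable_const (by fun_prop)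
  have hSx : S ⊆ {x}ᶜ := by
    rintro y hy rfl
    have : ρ ≤ ‖y - y‖ := hy
    rw [sub_self, norm_zero] at this
    linarith
  have heq : (fun y => K x y * b y) = fun y => S.indicator (K x) y * b y := by
    funext y
    by_cases hy : b y = 0
    · simp [hy]
    · rw [Set.indicator_of_mem (show y ∈ S from hs y hy)]
  rw [heq]
  refine hb.bdd_mul (c := c / ρ ^ d) ?_ (Filter.Eventually.of_forall fun y => ?_)
  · rw [aestronglyMeasurable_indicator_iff hS]
    exact ((hT.continuousOn_kernel hd x).mono hSx).aestronglyMeasurable hS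
  · by_cases hy : y ∈ S
    · rw [Set.indicator_of_mem hy]
      refine (hT.size x y fun h => hSx hy h.symm).trans ?_
      have hy' : ρ ≤ ‖x - y‖ := hy
      gcongr
    · rw [Set.indicator_of_notMem hy, norm_zero]
      positivity

/-- Off-diagonal estimate for a mean-zero function in the first argument: only the averages of `h`
over balls at scales at least `ρ` are needed. -/
theorem enorm_bilin_meanZero_left_le (hT : IsDiniCZO T K c ω) (hd : 1 ≤ d) {b h : RSpace d → ℂ}
    {p : RSpace d} {ρ β : ℝ} (hb : IsTest b) (hρ : 0 < ρ) (hβ : 0 ≤ β)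
    (hmean : ∫ y, b y = 0) (hdiam : ∀ y, b y ≠ 0 → 2 * ‖p - y‖ ≤ ρ)
    (hfar : ∀ x y, h x ≠ 0 → b y ≠ 0 → ρ ≤ ‖x - y‖) (hfarp : ∀ x, h x ≠ 0 → ρ ≤ ‖x - p‖)
    (hbd : ∀ r, ρ ≤ r → ∫⁻ x in Metric.ball p r, ‖h x‖ₑ ≤ ENNReal.ofReal (β * r ^ d)) :
    ‖bilin T b h‖ₑ ≤
      ENNReal.ofReal (c * β * 2 ^ (d + 1) * ∫ t in Set.Ioc (0 : ℝ) 1, ω t / t) *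
        ∫⁻ y, ‖b y‖ₑ := by
  have hc := hT.const_nonneg hd
  rw [bilin_eq T (hb.memLp 2)]
  refine (enorm_integral_le_lintegral_enorm _).trans ?_
  have hae : ∀ᵐ x, ‖T ((hb.memLp 2).toLp b) x * h x‖ₑ ≤
      ‖h x‖ₑ * ENNReal.ofReal (c / ‖x - p‖ ^ d * ω (ρ / 2 / ‖x - p‖)) * ∫⁻ y, ‖b y‖ₑ := by
    filter_upwards [hT.representation b (hb.memLp 2) hb.memLp_top hb.hasCompactSupport]
      with x hx
    by_cases hx0 : h x = 0
    · simp [hx0]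
    have hfx : ∀ y, b y ≠ 0 → ρ ≤ ‖x - y‖ := fun y hy => hfar x y hx0 hy
    have hint := hT.integrable_kernel_mul hd hb.integrable hρ hfx
    have heq : ∫ y, K x y * b y = ∫ y, (K x y - K x p) * b y := by
      simp only [sub_mul]
      rw [integral_sub hint (hb.integrable.const_mul _), integral_const_mul, hmean]
      simp
    rw [hx (notMem_tsupport_of_le_norm_sub hρ hfx), heq, enorm_mul, mul_comm, mul_assoc]
    refine mul_le_mul_right ((enorm_integral_le_lintegral_enorm _).trans ?_) _
    rw [← lintegral_const_mul' _ _ ENNReal.ofReal_ne_top]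
    refine lintegral_mono fun y => ?_
    rw [enorm_mul]
    by_cases hy : b y = 0
    · simp [hy]
    refine mul_le_mul_left ?_ _
    rw [← ofReal_norm]
    exact ENNReal.ofReal_le_ofReal
      (hT.norm_kernel_sub_le hd hρ (hdiam y hy) (hfarp x hx0)).1
  refine (lintegral_mono_ae hae).trans ?_
  rw [lintegral_mul_const' _ _ hb.integrable.2.ne]
  gcongr
  exact hT.modulus.lintegral_tail_le hc hρ hβ hbd hfarp

/-- Off-diagonal estimate for a mean-zero function in the second argument. -/
theorem enorm_bilin_meanZero_right_le (hT : IsDiniCZO T K c ω) (hd : 1 ≤ d) {b h : RSpace d → ℂ}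
    {p : RSpace d} {ρ β : ℝ} (hb : IsTest b) (hh : IsTest h) (hρ : 0 < ρ) (hβ : 0 ≤ β)
    (hmean : ∫ y, b y = 0) (hdiam : ∀ y, b y ≠ 0 → 2 * ‖p - y‖ ≤ ρ)
    (hfar : ∀ x y, h x ≠ 0 → b y ≠ 0 → ρ ≤ ‖x - y‖) (hfarp : ∀ x, h x ≠ 0 → ρ ≤ ‖x - p‖)
    (hbd : ∀ r, ρ ≤ r → ∫⁻ x in Metric.ball p r, ‖h x‖ₑ ≤ ENNReal.ofReal (β * r ^ d)) :
    ‖bilin T h b‖ₑ ≤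
      ENNReal.ofReal (c * β * 2 ^ (d + 1) * ∫ t in Set.Ioc (0 : ℝ) 1, ω t / t) *
        ∫⁻ y, ‖b y‖ₑ := by
  have hc := hT.const_nonneg hd
  have hp := hT.integrable_kernel_mul hd hh.integrable hρ
    fun y hy => norm_sub_rev y p ▸ hfarp y hy
  -- Subtracting the value at `p` of the kernel integral is free, as `b` has mean zero.
  have heq : bilin T h b =
      ∫ x, (T ((hh.memLp 2).toLp h) x - ∫ y, K p y * h y) * b x := by
    rw [bilin_eq T (hh.memLp 2)]
    simp only [sub_mul]
    rw [integral_sub (integrable_bilin T _ (hb.memLp 2)) (hb.integrable.const_mul _),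
      integral_const_mul, hmean]
    simp
  rw [heq]
  refine (enorm_integral_le_lintegral_enorm _).trans ?_
  rw [← lintegral_const_mul' _ _ ENNReal.ofReal_ne_top]
  refine lintegral_mono_ae ?_
  filter_upwards [hT.representation h (hh.memLp 2) hh.memLp_top hh.hasCompactSupport] with x hx
  by_cases hx0 : b x = 0
  · simp [hx0]
  have hfx : ∀ y, h y ≠ 0 → ρ ≤ ‖x - y‖ := fun y hy => norm_sub_rev y x ▸ hfar y x hy hx0
  rw [enorm_mul, hx (notMem_tsupport_of_le_norm_sub hρ hfx),
    ← integral_sub (hT.integrable_kernel_mul hd hh.integrable hρ hfx) hp]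
  refine mul_le_mul_left ((enorm_integral_le_lintegral_enorm _).trans ?_) _
  refine le_trans (lintegral_mono fun y => ?_)
    (hT.modulus.lintegral_tail_le hc hρ hβ hbd hfarp)
  rw [← sub_mul, enorm_mul]
  by_cases hy : h y = 0
  · simp [hy]
  rw [mul_comm]
  refine mul_le_mul_right ?_ _
  rw [← ofReal_norm]
  exact ENNReal.ofReal_le_ofReal
    (hT.norm_kernel_sub_le hd hρ (hdiam x hx0) (hfarp y hy)).2

end IsDiniCZO

/-! ### One step of the Calderón–Zygmund decomposition, for finitely many pieces -/

/-- The union of the pieces of the family that are near `P i`. -/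
def nearUnion {d : ℕ} {ι : Type*} (F : Finset ι) (P : ι → Set (RSpace d))
    (near : ι → ι → Prop) (i : ι) : Set (RSpace d) := ⋃ j ∈ F, ⋃ (_ : near i j), P j

/-- A finite disjoint family of sets `P i` of diameter at most `ρ i / 2` and measure at least
`γ (ρ i) ^ d`, with a symmetric relation `near` such that pieces which are not near are separated
by at least their scales, while the pieces near `P i` have total measure at most `κ |P i|`. -/
structure IsSeparatedFamily {d : ℕ} {ι : Type*} (F : Finset ι) (P : ι → Set (RSpace d))
    (ρ : ι → ℝ) (near : ι → ι → Prop) (γ κ : ℝ) : Prop where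
  meas : ∀ i ∈ F, MeasurableSet (P i)
  bdd : ∀ i ∈ F, Bornology.IsBounded (P i)
  nonempty : ∀ i ∈ F, (P i).Nonempty
  disj : ∀ i ∈ F, ∀ j ∈ F, i ≠ j → Disjoint (P i) (P j)
  pos : ∀ i ∈ F, 0 < ρ i
  diam : ∀ i ∈ F, ∀ x ∈ P i, ∀ y ∈ P i, 2 * ‖x - y‖ ≤ ρ i
  vol : ∀ i ∈ F, γ * ρ i ^ d ≤ volume.real (P i)
  symm : ∀ i j, near i j → near j i
  far : ∀ i ∈ F, ∀ j ∈ F, ¬ near i j → ∀ x ∈ P i, ∀ y ∈ P j, ρ i ≤ ‖x - y‖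
  vol_near : ∀ i ∈ F, volume.real (nearUnion F P near i) ≤ κ * volume.real (P i)

/-- A test function supported in `X` whose size is controlled by `α`: pointwise outside the pieces
`P i`, and in average over all balls centred in `P i` of radius at least `ρ i`; outside the pieces,
it vanishes up to distance `ρ i` from `P i`. -/
structure IsControlled {d : ℕ} {ι : Type*} (F : Finset ι) (P : ι → Set (RSpace d))
    (ρ : ι → ℝ) (X : Set (RSpace d)) (u : RSpace d → ℂ) (α : ℝ) : Prop where
  test : IsTest u
  nonneg : 0 ≤ α
  support : Function.support u ⊆ X
  bound : ∀ᵐ x, (∀ i ∈ F, x ∉ P i) → ‖u x‖ ≤ α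
  average : ∀ i ∈ F, ∀ p ∈ P i, ∀ r, ρ i ≤ r →
    ∫⁻ x in Metric.ball p r, ‖u x‖ₑ ≤ ENNReal.ofReal (α * r ^ d)
  away : ∀ i ∈ F, ∀ x ∈ P i, ∀ y, (∀ j ∈ F, y ∉ P j) → u y ≠ 0 → ρ i ≤ ‖x - y‖

/-- The bad part of `u` on the set `P`: the function minus its mean over `P`. -/
noncomputable def badPart {d : ℕ} (u : RSpace d → ℂ) (P : Set (RSpace d)) : RSpace d → ℂ :=
  P.indicator fun x => u x - ⨍ y in P, u y

/-- The good part of `u`, which is `u` outside the sets `P i` and the mean of `u` on each of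
them. -/
noncomputable def goodPart {d : ℕ} {ι : Type*} (F : Finset ι) (P : ι → Set (RSpace d))
    (u : RSpace d → ℂ) : RSpace d → ℂ :=
  u - ∑ i ∈ F, badPart u (P i)

section

variable {d : ℕ} {ι : Type*} {F : Finset ι} {P : ι → Set (RSpace d)} {ρ : ι → ℝ}
  {near : ι → ι → Prop} {γ κ : ℝ} {X : Set (RSpace d)} {u : RSpace d → ℂ} {α : ℝ}

theorem norm_le_of_enorm_le {z : ℂ} {a : ℝ} (ha : 0 ≤ a) (h : ‖z‖ₑ ≤ ENNReal.ofReal a) :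
    ‖z‖ ≤ a := by
  rw [← toReal_enorm]
  exact ENNReal.toReal_le_of_le_ofReal ha h

theorem badPart_of_mem {Q : Set (RSpace d)} {x : RSpace d} (hx : x ∈ Q) :
    badPart u Q x = u x - ⨍ y in Q, u y := Set.indicator_of_mem hx _

theorem badPart_of_notMem {Q : Set (RSpace d)} {x : RSpace d} (hx : x ∉ Q) :
    badPart u Q x = 0 := Set.indicator_of_notMem hx _

theorem mem_of_badPart_ne_zero {Q : Set (RSpace d)} {x : RSpace d} (hx : badPart u Q x ≠ 0) :
    x ∈ Q := by
  by_contra h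
  exact hx (badPart_of_notMem h)

theorem IsTest.badPart (hu : IsTest u) {Q : Set (RSpace d)} (hQ : MeasurableSet Q)
    (hb : Bornology.IsBounded Q) : IsTest (badPart u Q) := by
  have h : _root_.badPart u Q = Q.indicator u - Q.indicator fun _ => ⨍ y in Q, u y := by
    ext x
    by_cases hx : x ∈ Q
    · simp [hx, badPart_of_mem hx]
    · simp [hx, badPart_of_notMem hx]
  rw [h]
  exact (hu.indicator hQ).sub (IsTest.indicator_const hQ hb _)

theorem integral_badPart {Q : Set (RSpace d)} (hQ : MeasurableSet Q)
    (hb : Bornology.IsBounded Q) : ∫ x, badPart u Q x = 0 := by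
  have : IsFiniteMeasure (volume.restrict Q) := ⟨by
    rw [Measure.restrict_apply_univ]; exact hb.measure_lt_top⟩
  rw [badPart, integral_indicator hQ]
  exact integral_sub_average _ _

theorem goodPart_of_notMem {x : RSpace d} (hx : ∀ i ∈ F, x ∉ P i) : goodPart F P u x = u x := by
  rw [goodPart, Pi.sub_apply, Finset.sum_apply, Finset.sum_eq_zero, sub_zero]
  exact fun i hi => badPart_of_notMem (hx i hi)

namespace IsSeparatedFamily

theorem goodPart_of_mem (hF : IsSeparatedFamily F P ρ near γ κ) {i : ι} (hi : i ∈ F)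
    {x : RSpace d} (hx : x ∈ P i) : goodPart F P u x = ⨍ y in P i, u y := by
  rw [goodPart, Pi.sub_apply, Finset.sum_apply, Finset.sum_eq_single i, badPart_of_mem hx]
  · ring
  · intro j hj hji
    exact badPart_of_notMem fun h => Set.disjoint_left.1 (hF.disj j hj i hi hji) h hx
  · exact fun h => absurd hi h

theorem isTest_badPart (hF : IsSeparatedFamily F P ρ near γ κ) (hu : IsTest u) :
    ∀ i ∈ F, IsTest (badPart u (P i)) := fun i hi => hu.badPart (hF.meas i hi) (hF.bdd i hi)

theorem isTest_goodPart (hF : IsSeparatedFamily F P ρ near γ κ) (hu : IsTest u) :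
    IsTest (goodPart F P u) := hu.sub (IsTest.sum F (hF.isTest_badPart hu))

theorem lintegral_piece_le (hF : IsSeparatedFamily F P ρ near γ κ) (hγ : 0 < γ)
    (hu : IsControlled F P ρ X u α) {i : ι} (hi : i ∈ F) :
    ∫⁻ x in P i, ‖u x‖ₑ ≤ ENNReal.ofReal (α / γ * volume.real (P i)) := by
  obtain ⟨p, hp⟩ := hF.nonempty i hi
  have hρ := hF.pos i hi
  have hsub : P i ⊆ Metric.ball p (ρ i) := fun x hx => by
    rw [Metric.mem_ball, dist_eq_norm]
    linarith [hF.diam i hi x hx p hp, norm_nonneg (x - p)]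
  refine (lintegral_mono_set hsub).trans ((hu.average i hi p hp _ le_rfl).trans ?_)
  refine ENNReal.ofReal_le_ofReal ?_
  have := hu.nonneg
  calc α * ρ i ^ d = α / γ * (γ * ρ i ^ d) := by field_simp
    _ ≤ _ := by gcongr; exact hF.vol i hi

theorem volume_piece_pos (hF : IsSeparatedFamily F P ρ near γ κ) (hγ : 0 < γ) {i : ι}
    (hi : i ∈ F) : 0 < volume.real (P i) :=
  lt_of_lt_of_le (mul_pos hγ (pow_pos (hF.pos i hi) d)) (hF.vol i hi)

theorem norm_average_le (hF : IsSeparatedFamily F P ρ near γ κ) (hγ : 0 < γ)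
    (hu : IsControlled F P ρ X u α) {i : ι} (hi : i ∈ F) : ‖⨍ y in P i, u y‖ ≤ α / γ := by
  have hpos := hF.volume_piece_pos hγ hi
  have hα := hu.nonneg
  rw [setAverage_eq, norm_smul, norm_inv, Real.norm_of_nonneg hpos.le, inv_mul_le_iff₀ hpos,
    mul_comm]
  refine (norm_integral_le_lintegral_norm _).trans
    (ENNReal.toReal_le_of_le_ofReal (by positivity) ?_)
  simpa only [ofReal_norm] using hF.lintegral_piece_le hγ hu hi

theorem lintegral_badPart_le (hF : IsSeparatedFamily F P ρ near γ κ) (hγ : 0 < γ)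
    (hu : IsControlled F P ρ X u α) {i : ι} (hi : i ∈ F) :
    ∫⁻ x, ‖badPart u (P i) x‖ₑ ≤ ENNReal.ofReal (2 * (α / γ) * volume.real (P i)) := by
  have hα := hu.nonneg
  simp only [badPart, enorm_indicator_eq_indicator_enorm]
  rw [lintegral_indicator (hF.meas i hi)]
  calc ∫⁻ x in P i, ‖u x - ⨍ y in P i, u y‖ₑ
      ≤ ∫⁻ x in P i, (‖u x‖ₑ + ENNReal.ofReal (α / γ)) := by
        refine lintegral_mono fun x => (enorm_sub_le).trans ?_
        gcongr
        rw [← ofReal_norm]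
        exact ENNReal.ofReal_le_ofReal (hF.norm_average_le hγ hu hi)
    _ = (∫⁻ x in P i, ‖u x‖ₑ) + ENNReal.ofReal (α / γ) * volume (P i) := by
        rw [lintegral_add_right _ measurable_const, setLIntegral_const]
    _ ≤ ENNReal.ofReal (α / γ * volume.real (P i)) +
          ENNReal.ofReal (α / γ) * ENNReal.ofReal (volume.real (P i)) := by
        rw [ofReal_measureReal (hF.bdd i hi).measure_lt_top.ne]
        gcongr
        exact hF.lintegral_piece_le hγ hu hi
    _ = _ := by
        rw [← ENNReal.ofReal_mul (by positivity), ← ENNReal.ofReal_add (by positivity)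
          (by positivity)]
        congr 1
        ring

theorem norm_goodPart_le (hF : IsSeparatedFamily F P ρ near γ κ) (hγ : 0 < γ) (hγ1 : γ ≤ 1)
    (hu : IsControlled F P ρ X u α) : ∀ᵐ x, ‖goodPart F P u x‖ ≤ α / γ := by
  filter_upwards [hu.bound] with x hx
  by_cases h : ∃ i ∈ F, x ∈ P i
  · obtain ⟨i, hi, hxi⟩ := h
    rw [hF.goodPart_of_mem hi hxi]
    exact hF.norm_average_le hγ hu hi
  · push Not at h
    rw [goodPart_of_notMem h]
    exact (hx h).trans (le_div_self hu.nonneg hγ hγ1)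

theorem support_goodPart_subset (hu : IsControlled F P ρ X u α) (hX : ∀ i ∈ F, P i ⊆ X) :
    Function.support (goodPart F P u) ⊆ X := by
  intro x hx
  by_cases h : ∃ i ∈ F, x ∈ P i
  · obtain ⟨i, hi, hxi⟩ := h
    exact hX i hi hxi
  · push Not at h
    rw [Function.mem_support, goodPart_of_notMem h] at hx
    exact hu.support hx

theorem lintegral_ball_le_of_bound {w : RSpace d → ℂ} {a : ℝ} (ha : 0 ≤ a)
    (hw : ∀ᵐ x, ‖w x‖ ≤ a) (p : RSpace d) {r : ℝ} (hr : 0 ≤ r) :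
    ∫⁻ x in Metric.ball p r, ‖w x‖ₑ ≤
      ENNReal.ofReal (a * volume.real (Metric.ball (0 : RSpace d) 1) * r ^ d) := by
  calc ∫⁻ x in Metric.ball p r, ‖w x‖ₑ ≤ ∫⁻ _ in Metric.ball p r, ENNReal.ofReal a := by
        refine lintegral_mono_ae (ae_restrict_of_ae ?_)
        filter_upwards [hw] with x hx
        rw [← ofReal_norm]
        exact ENNReal.ofReal_le_ofReal hx
    _ ≤ ENNReal.ofReal a * volume (Metric.closedBall p r) := by
        rw [setLIntegral_const]
        gcongr
        exact Metric.ball_subset_closedBall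
    _ = _ := by
        rw [Measure.addHaar_closedBall _ _ hr, ← ofReal_measureReal (s := Metric.ball 0 1)
          measure_ball_lt_top.ne, ← ENNReal.ofReal_mul (by positivity),
          ← ENNReal.ofReal_mul (by positivity), finrank_euclideanSpace_fin]
        congr 1
        ring

theorem notNear_or_notMem {j : ι} {x : RSpace d} (hx : x ∉ nearUnion F P near j) :
    (∃ i ∈ F, x ∈ P i ∧ ¬ near j i) ∨ ∀ i ∈ F, x ∉ P i := by
  by_cases h : ∃ i ∈ F, x ∈ P i
  · obtain ⟨i, hi, hxi⟩ := h
    refine Or.inl ⟨i, hi, hxi, fun hn => hx ?_⟩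
    simp only [nearUnion, Set.mem_iUnion]
    exact ⟨i, hi, hn, hxi⟩
  · push Not at h
    exact Or.inr h

end IsSeparatedFamily

end

section

variable {d : ℕ} {ι : Type*} {F : Finset ι} {P : ι → Set (RSpace d)} {ρ : ι → ℝ}
  {near : ι → ι → Prop} {γ κ : ℝ} {X : Set (RSpace d)} {u u₁ u₂ : RSpace d → ℂ} {α α₁ α₂ : ℝ}
  {T : L2Space d →L[ℂ] L2Space d} {K : RSpace d → RSpace d → ℂ} {c : ℝ} {ω : ℝ → ℝ}

namespace IsSeparatedFamily

theorem measurableSet_nearUnion (hF : IsSeparatedFamily F P ρ near γ κ) (i : ι) :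
    MeasurableSet (nearUnion F P near i) :=
  Finset.measurableSet_biUnion _ fun j hj => MeasurableSet.iUnion fun _ => hF.meas j hj

theorem bdd_nearUnion (hF : IsSeparatedFamily F P ρ near γ κ) (i : ι) :
    Bornology.IsBounded (nearUnion F P near i) := by
  refine (Bornology.isBounded_biUnion_finset F).2 fun j hj => ?_
  exact (hF.bdd j hj).subset (Set.iUnion_subset fun _ => le_rfl)

open Classical in
/-- On the union of the near pieces, a function is the sum of its restrictions to them. -/
theorem indicator_nearUnion (hF : IsSeparatedFamily F P ρ near γ κ) (i : ι)
    (w : RSpace d → ℂ) :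
    (nearUnion F P near i).indicator w =
      ∑ j ∈ F with near i j, (P j).indicator w := by
  have h : nearUnion F P near i = ⋃ j ∈ F.filter (near i), P j := by
    ext x
    simp only [nearUnion, Set.mem_iUnion, Finset.mem_filter, exists_prop]
    exact ⟨fun ⟨j, h1, h2, h3⟩ => ⟨j, ⟨h1, h2⟩, h3⟩, fun ⟨j, ⟨h1, h2⟩, h3⟩ => ⟨j, h1, h2, h3⟩⟩
  rw [h, Finset.indicator_biUnion]
  · ext x
    simp
  · intro a ha b hb hab
    exact hF.disj a (Finset.mem_filter.1 ha).1 b (Finset.mem_filter.1 hb).1 hab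

theorem eq_goodPart_add (u : RSpace d → ℂ) :
    u = goodPart F P u + ∑ i ∈ F, badPart u (P i) := by
  rw [goodPart, sub_add_cancel]

theorem indicator_piece_eq (hF : IsSeparatedFamily F P ρ near γ κ) {i : ι} (hi : i ∈ F)
    (u : RSpace d → ℂ) :
    (P i).indicator u = badPart u (P i) + (P i).indicator (goodPart F P u) := by
  ext x
  by_cases hx : x ∈ P i
  · simp [hx, badPart_of_mem hx, hF.goodPart_of_mem hi hx]
  · simp [hx, badPart_of_notMem hx]

open Classical in
/-- The algebraic identity behind the decomposition: once the interactions between near pieces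
are removed, every remaining term involving a bad part is off-diagonal. -/
theorem bilin_sub_sum_eq (hF : IsSeparatedFamily F P ρ near γ κ) (hu₁ : IsTest u₁)
    (hu₂ : IsTest u₂) :
    bilin T u₁ u₂ - ∑ i ∈ F, bilin T ((P i).indicator u₁) ((nearUnion F P near i).indicator u₂) =
      (∑ i ∈ F, bilin T (badPart u₁ (P i)) ((nearUnion F P near i)ᶜ.indicator u₂)) +
      bilin T (goodPart F P u₁) (goodPart F P u₂) -
      (∑ i ∈ F, bilin T ((P i).indicator (goodPart F P u₁))
        ((nearUnion F P near i).indicator (goodPart F P u₂))) +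
      ∑ j ∈ F, bilin T ((nearUnion F P near j)ᶜ.indicator (goodPart F P u₁))
        (badPart u₂ (P j)) := by
  set g₁ := goodPart F P u₁ with hg₁
  set g₂ := goodPart F P u₂ with hg₂
  set E := nearUnion F P near with hE
  have hEm := hF.measurableSet_nearUnion
  have tg₁ : IsTest g₁ := hF.isTest_goodPart hu₁
  have tg₂ : IsTest g₂ := hF.isTest_goodPart hu₂
  have tb₁ := hF.isTest_badPart hu₁
  have tb₂ := hF.isTest_badPart hu₂
  have e1 : bilin T u₁ u₂ = bilin T g₁ u₂ + ∑ i ∈ F, bilin T (badPart u₁ (P i)) u₂ := by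
    conv_lhs => rw [eq_goodPart_add (F := F) (P := P) u₁]
    rw [bilin_add_left T tg₁ (IsTest.sum F tb₁) hu₂, bilin_sum_left T F tb₁ hu₂]
  have e2 : bilin T g₁ u₂ = bilin T g₁ g₂ + ∑ j ∈ F, bilin T g₁ (badPart u₂ (P j)) := by
    conv_lhs => rw [eq_goodPart_add (F := F) (P := P) u₂]
    rw [bilin_add_right T tg₁ tg₂ (IsTest.sum F tb₂), bilin_sum_right T F tg₁ tb₂]
  have e3 : ∀ i ∈ F, bilin T (badPart u₁ (P i)) u₂ =
      bilin T (badPart u₁ (P i)) ((E i).indicator u₂) +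
        bilin T (badPart u₁ (P i)) ((E i)ᶜ.indicator u₂) := by
    intro i hi
    rw [← bilin_add_right T (tb₁ i hi) (hu₂.indicator (hEm i)) (hu₂.indicator (hEm i).compl),
      Set.indicator_self_add_compl]
  have e4 : ∀ i ∈ F, bilin T ((P i).indicator u₁) ((E i).indicator u₂) =
      bilin T (badPart u₁ (P i)) ((E i).indicator u₂) +
        bilin T ((P i).indicator g₁) ((E i).indicator u₂) := by
    intro i hi
    rw [← bilin_add_left T (tb₁ i hi) (tg₁.indicator (hF.meas i hi)) (hu₂.indicator (hEm i)),
      ← hF.indicator_piece_eq hi]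
  have e5 : ∀ i ∈ F, bilin T ((P i).indicator g₁) ((E i).indicator u₂) =
      bilin T ((P i).indicator g₁) ((E i).indicator g₂) +
        ∑ j ∈ F, if near i j then bilin T ((P i).indicator g₁) (badPart u₂ (P j)) else 0 := by
    intro i hi
    have tp := tg₁.indicator (hF.meas i hi)
    have h : (E i).indicator u₂ =
        (E i).indicator g₂ + ∑ j ∈ F with near i j, badPart u₂ (P j) := by
      rw [hF.indicator_nearUnion i u₂, hF.indicator_nearUnion i g₂, ← Finset.sum_add_distrib]
      refine Finset.sum_congr rfl fun j hj => ?_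
      rw [add_comm]
      exact hF.indicator_piece_eq (Finset.mem_filter.1 hj).1 u₂
    have tb' : ∀ j ∈ F.filter (near i), IsTest (badPart u₂ (P j)) := fun j hj =>
      tb₂ j (Finset.mem_filter.1 hj).1
    rw [h, bilin_add_right T tp (tg₂.indicator (hEm i)) (IsTest.sum _ tb'),
      bilin_sum_right T _ tp tb', Finset.sum_filter]
  have e6 : ∀ j ∈ F, bilin T g₁ (badPart u₂ (P j)) =
      (∑ i ∈ F, if near i j then bilin T ((P i).indicator g₁) (badPart u₂ (P j)) else 0) +
        bilin T ((E j)ᶜ.indicator g₁) (badPart u₂ (P j)) := by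
    intro j hj
    have h1 : bilin T g₁ (badPart u₂ (P j)) = bilin T ((E j).indicator g₁) (badPart u₂ (P j)) +
        bilin T ((E j)ᶜ.indicator g₁) (badPart u₂ (P j)) := by
      rw [← bilin_add_left T (tg₁.indicator (hEm j)) (tg₁.indicator (hEm j).compl) (tb₂ j hj),
        Set.indicator_self_add_compl]
    rw [h1, hF.indicator_nearUnion j g₁, bilin_sum_left T _
      (fun i hi => tg₁.indicator (hF.meas i (Finset.mem_filter.1 hi).1)) (tb₂ j hj),
      Finset.sum_filter]
    congr 1
    refine Finset.sum_congr rfl fun i _ => ?_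
    have : near j i ↔ near i j := ⟨hF.symm _ _, hF.symm _ _⟩
    simp only [this]
  rw [e1, e2, Finset.sum_congr rfl e3, Finset.sum_congr rfl e4, Finset.sum_congr rfl e6]
  simp only [Finset.sum_add_distrib]
  rw [Finset.sum_congr rfl e5, Finset.sum_add_distrib, Finset.sum_comm (s := F) (t := F)
    (f := fun i j => if near i j then bilin T ((P i).indicator g₁) (badPart u₂ (P j)) else 0)]
  ring

theorem norm_bilin_badPart_left_le (hF : IsSeparatedFamily F P ρ near γ κ) (hd : 1 ≤ d)
    (hT : IsDiniCZO T K c ω) (hγ : 0 < γ)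
    (hu₁ : IsControlled F P ρ X u₁ α₁) (hu₂ : IsControlled F P ρ X u₂ α₂) {i : ι} (hi : i ∈ F) :
    ‖bilin T (badPart u₁ (P i)) ((nearUnion F P near i)ᶜ.indicator u₂)‖ ≤
      (c * α₂ * 2 ^ (d + 1) * ∫ t in Set.Ioc (0 : ℝ) 1, ω t / t) *
        (2 * (α₁ / γ) * volume.real (P i)) := by
  obtain ⟨p, hp⟩ := hF.nonempty i hi
  have hc := hT.const_nonneg hd
  have hI := hT.modulus.dini_nonneg
  have h1 := hu₁.nonneg
  have h2 := hu₂.nonneg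
  have hfar : ∀ x, (nearUnion F P near i)ᶜ.indicator u₂ x ≠ 0 → ∀ y ∈ P i, ρ i ≤ ‖x - y‖ := by
    intro x hx y hy
    have hxE : x ∉ nearUnion F P near i := Set.mem_of_indicator_ne_zero hx
    rw [Set.indicator_of_mem (show x ∈ (nearUnion F P near i)ᶜ from hxE)] at hx
    rw [norm_sub_rev]
    rcases notNear_or_notMem hxE with ⟨j, hj, hxj, hn⟩ | h
    · exact hF.far i hi j hj hn y hy x hxj
    · exact hu₂.away i hi y hy x h hx
  refine norm_le_of_enorm_le (by positivity) ?_
  rw [ENNReal.ofReal_mul (by positivity)]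
  refine (hT.enorm_bilin_meanZero_left_le hd (hF.isTest_badPart hu₁.test i hi) (hF.pos i hi) h2
    (integral_badPart (hF.meas i hi) (hF.bdd i hi))
    (fun y hy => hF.diam i hi p hp y (mem_of_badPart_ne_zero hy))
    (fun x y hx hy => hfar x hx y (mem_of_badPart_ne_zero hy))
    (fun x hx => hfar x hx p hp) (fun r hr => ?_)).trans ?_
  · refine le_trans (lintegral_mono fun x => ?_) (hu₂.average i hi p hp r hr)
    exact enorm_indicator_le_enorm_self _ _
  · gcongr
    exact hF.lintegral_badPart_le hγ hu₁ hi

theorem norm_bilin_badPart_right_le (hF : IsSeparatedFamily F P ρ near γ κ) (hd : 1 ≤ d)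
    (hT : IsDiniCZO T K c ω) (hγ : 0 < γ) (hγ1 : γ ≤ 1)
    (hu₁ : IsControlled F P ρ X u₁ α₁) (hu₂ : IsControlled F P ρ X u₂ α₂) {i : ι} (hi : i ∈ F) :
    ‖bilin T ((nearUnion F P near i)ᶜ.indicator (goodPart F P u₁)) (badPart u₂ (P i))‖ ≤
      (c * (α₁ / γ * volume.real (Metric.ball (0 : RSpace d) 1)) * 2 ^ (d + 1) *
        ∫ t in Set.Ioc (0 : ℝ) 1, ω t / t) * (2 * (α₂ / γ) * volume.real (P i)) := by
  obtain ⟨p, hp⟩ := hF.nonempty i hi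
  have hc := hT.const_nonneg hd
  have hI := hT.modulus.dini_nonneg
  have h1 := hu₁.nonneg
  have h2 := hu₂.nonneg
  have hfar : ∀ x, (nearUnion F P near i)ᶜ.indicator (goodPart F P u₁) x ≠ 0 →
      ∀ y ∈ P i, ρ i ≤ ‖x - y‖ := by
    intro x hx y hy
    have hxE : x ∉ nearUnion F P near i := Set.mem_of_indicator_ne_zero hx
    rw [Set.indicator_of_mem (show x ∈ (nearUnion F P near i)ᶜ from hxE)] at hx
    rw [norm_sub_rev]
    rcases notNear_or_notMem hxE with ⟨j, hj, hxj, hn⟩ | h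
    · exact hF.far i hi j hj hn y hy x hxj
    · rw [goodPart_of_notMem h] at hx
      exact hu₁.away i hi y hy x h hx
  refine norm_le_of_enorm_le (by positivity) ?_
  rw [ENNReal.ofReal_mul (by positivity)]
  refine (hT.enorm_bilin_meanZero_right_le hd
    (β := α₁ / γ * volume.real (Metric.ball (0 : RSpace d) 1)) (hF.isTest_badPart hu₂.test i hi)
    ((hF.isTest_goodPart hu₁.test).indicator (hF.measurableSet_nearUnion i).compl)
    (hF.pos i hi) (by positivity)
    (integral_badPart (hF.meas i hi) (hF.bdd i hi))
    (fun y hy => hF.diam i hi p hp y (mem_of_badPart_ne_zero hy))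
    (fun x y hx hy => hfar x hx y (mem_of_badPart_ne_zero hy))
    (fun x hx => hfar x hx p hp) (fun r hr => ?_)).trans ?_
  · refine le_trans (lintegral_mono fun x => ?_)
      (lintegral_ball_le_of_bound (by positivity) (hF.norm_goodPart_le hγ hγ1 hu₁) p
        ((hF.pos i hi).le.trans hr))
    exact enorm_indicator_le_enorm_self _ _
  · gcongr
    exact hF.lintegral_badPart_le hγ hu₂ hi

theorem sum_volume_le (hF : IsSeparatedFamily F P ρ near γ κ) (hX : volume X ≠ ∞)
    (hPX : ∀ i ∈ F, P i ⊆ X) : ∑ i ∈ F, volume.real (P i) ≤ volume.real X := by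
  rw [← measureReal_biUnion_finset (fun i hi j hj hij => hF.disj i hi j hj hij) hF.meas
    fun i hi => (hF.bdd i hi).measure_lt_top.ne]
  exact measureReal_mono (Set.iUnion₂_subset hPX) hX

/-- The Calderón–Zygmund decomposition of both functions: up to an error of the right size, the form
is the sum of its localizations to pairs of near pieces. -/
theorem norm_bilin_sub_sum_le (hF : IsSeparatedFamily F P ρ near γ κ) (hd : 1 ≤ d)
    (hT : IsDiniCZO T K c ω) (hγ : 0 < γ) (hγ1 : γ ≤ 1) (hκ : 1 ≤ κ) (hX : volume X ≠ ∞)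
    (hPX : ∀ i ∈ F, P i ⊆ X)
    (hu₁ : IsControlled F P ρ X u₁ α₁) (hu₂ : IsControlled F P ρ X u₂ α₂) :
    ‖bilin T u₁ u₂ -
      ∑ i ∈ F, bilin T ((P i).indicator u₁) ((nearUnion F P near i).indicator u₂)‖ ≤
      (2 ^ (d + 2) * (1 + volume.real (Metric.ball (0 : RSpace d) 1)) + 1 + κ) / γ ^ 2 *
        (‖T‖ + c * ∫ t in Set.Ioc (0 : ℝ) 1, ω t / t) * (α₁ * α₂ * volume.real X) := by
  have hc := hT.const_nonneg hd
  have hI := hT.modulus.dini_nonneg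
  have h1 := hu₁.nonneg
  have h2 := hu₂.nonneg
  have hsum := hF.sum_volume_le hX hPX
  set V := volume.real X
  set v := volume.real (Metric.ball (0 : RSpace d) 1)
  set I := ∫ t in Set.Ioc (0 : ℝ) 1, ω t / t
  have hv : 0 ≤ v := measureReal_nonneg
  have hV : 0 ≤ V := measureReal_nonneg
  have b1 := hF.norm_goodPart_le hγ hγ1 hu₁
  have b2 := hF.norm_goodPart_le hγ hγ1 hu₂
  have t1 := hF.isTest_goodPart hu₁.test
  have t2 := hF.isTest_goodPart hu₂.test
  have s1 : ‖∑ i ∈ F, bilin T (badPart u₁ (P i)) ((nearUnion F P near i)ᶜ.indicator u₂)‖ ≤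
      (c * α₂ * 2 ^ (d + 1) * I) * (2 * (α₁ / γ) * V) := by
    refine (norm_sum_le_of_le F fun i hi =>
      hF.norm_bilin_badPart_left_le hd hT hγ hu₁ hu₂ hi).trans ?_
    rw [← Finset.mul_sum, ← Finset.mul_sum]
    gcongr
  have s2 : ‖∑ i ∈ F, bilin T ((nearUnion F P near i)ᶜ.indicator (goodPart F P u₁))
      (badPart u₂ (P i))‖ ≤
      (c * (α₁ / γ * v) * 2 ^ (d + 1) * I) * (2 * (α₂ / γ) * V) := by
    refine (norm_sum_le_of_le F fun i hi =>
      hF.norm_bilin_badPart_right_le hd hT hγ hγ1 hu₁ hu₂ hi).trans ?_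
    rw [← Finset.mul_sum, ← Finset.mul_sum]
    gcongr
  have s3 : ‖bilin T (goodPart F P u₁) (goodPart F P u₂)‖ ≤
      ‖T‖ * (α₁ / γ) * (α₂ / γ) * V := by
    have h := norm_bilin_le T t1 t2 (by positivity) (by positivity) hX hX b1 b2
      (support_goodPart_subset hu₁ hPX) (support_goodPart_subset hu₂ hPX)
    rwa [Real.sqrt_mul_self hV] at h
  have s4 : ‖∑ i ∈ F, bilin T ((P i).indicator (goodPart F P u₁))
        ((nearUnion F P near i).indicator (goodPart F P u₂))‖ ≤
      ‖T‖ * (α₁ / γ) * (α₂ / γ) * (κ * V) := by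
    refine (norm_sum_le_of_le F (n := fun i => ‖T‖ * (α₁ / γ) * (α₂ / γ) *
      (κ * volume.real (P i))) fun i hi => ?_).trans ?_
    · refine (norm_bilin_le T (t1.indicator (hF.meas i hi))
        (t2.indicator (hF.measurableSet_nearUnion i)) (by positivity) (by positivity)
        (hF.bdd i hi).measure_lt_top.ne (hF.bdd_nearUnion i).measure_lt_top.ne
        (ae_norm_indicator_le _ b1) (ae_norm_indicator_le _ b2)
        Set.support_indicator_subset Set.support_indicator_subset).trans ?_
      gcongr
      refine Real.sqrt_le_iff.2 ⟨by positivity, ?_⟩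
      have h := hF.vol_near i hi
      have hp : 0 ≤ volume.real (P i) := measureReal_nonneg
      calc volume.real (P i) * volume.real (nearUnion F P near i)
          ≤ volume.real (P i) * (κ * volume.real (P i)) := by gcongr
        _ ≤ (κ * volume.real (P i)) * (κ * volume.real (P i)) := by
            gcongr
            exact le_mul_of_one_le_left hp hκ
        _ = _ := by ring
    · rw [← Finset.mul_sum, ← Finset.mul_sum]
      gcongr
  rw [hF.bilin_sub_sum_eq hu₁.test hu₂.test]
  refine (norm_add_le _ _).trans ((add_le_add_left (norm_sub_le _ _) _).trans
    ((add_le_add_left (add_le_add_left (norm_add_le _ _) _) _).trans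
    ((add_le_add (add_le_add (add_le_add s1 s3) s4) s2).trans ?_)))
  have e : (c * α₂ * 2 ^ (d + 1) * I) * (2 * (α₁ / γ) * V) + ‖T‖ * (α₁ / γ) * (α₂ / γ) * V +
      ‖T‖ * (α₁ / γ) * (α₂ / γ) * (κ * V) +
      (c * (α₁ / γ * v) * 2 ^ (d + 1) * I) * (2 * (α₂ / γ) * V) =
      (2 ^ (d + 2) * (γ + v) * (c * I) + (1 + κ) * ‖T‖) / γ ^ 2 * (α₁ * α₂ * V) := by
    field_simp
    ring
  rw [e]
  have hT0 := norm_nonneg T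
  have hcI : 0 ≤ c * I := by positivity
  have hnum : 2 ^ (d + 2) * (γ + v) * (c * I) + (1 + κ) * ‖T‖ ≤
      (2 ^ (d + 2) * (1 + v) + 1 + κ) * (‖T‖ + c * I) := by
    have hA : 2 ^ (d + 2) * (γ + v) * (c * I) ≤ 2 ^ (d + 2) * (1 + v) * (c * I) := by gcongr
    have hB : 0 ≤ 2 ^ (d + 2) * (1 + v) * ‖T‖ := by positivity
    have hC : 0 ≤ (1 + κ) * (c * I) := by positivity
    linarith
  calc _ ≤ (2 ^ (d + 2) * (1 + v) + 1 + κ) * (‖T‖ + c * I) / γ ^ 2 * (α₁ * α₂ * V) := by gcongr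
    _ = _ := by ring

end IsSeparatedFamily

end

/-! ### The weak type bound and the Lebesgue bound for the maximal function -/

/-- The set where the uncentred maximal function of `f` exceeds `t`: the union of the interiors
of all balls over which the average of `f` exceeds `t`. -/
def maximalSet {d : ℕ} (f : RSpace d → ℝ≥0∞) (t : ℝ≥0∞) : Set (RSpace d) :=
  {x | ∃ (y : RSpace d) (r : ℝ), x ∈ Metric.ball y r ∧
    t * volume (Metric.closedBall y r) < ∫⁻ z in Metric.closedBall y r, f z}

section maximal

variable {d : ℕ} {f : RSpace d → ℝ≥0∞} {t : ℝ≥0∞}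

theorem isOpen_maximalSet : IsOpen (maximalSet f t) := by
  rw [isOpen_iff_mem_nhds]
  rintro x ⟨y, r, hx, h⟩
  filter_upwards [Metric.isOpen_ball.mem_nhds hx] with z hz
  exact ⟨y, r, hz, h⟩

theorem lintegral_closedBall_le_of_notMem {x y : RSpace d} {r : ℝ} (hx : x ∉ maximalSet f t)
    (hxy : x ∈ Metric.ball y r) :
    ∫⁻ z in Metric.closedBall y r, f z ≤ t * volume (Metric.closedBall y r) := by
  by_contra h
  exact hx ⟨y, r, hxy, not_le.1 h⟩

theorem radius_le (hd : 1 ≤ d) {x : RSpace d} {r : ℝ} {M : ℝ≥0∞} (hM : M ≠ ∞)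
    (h : volume (Metric.ball x r) ≤ M) :
    r ≤ max 1 (M / volume (Metric.ball (0 : RSpace d) 1)).toReal := by
  rcases le_or_gt r 1 with hr | hr
  · exact hr.trans (le_max_left _ _)
  refine le_trans ?_ (le_max_right _ _)
  have hr0 : 0 ≤ r := by linarith
  have hv := (Metric.measure_ball_pos volume (0 : RSpace d) one_pos).ne'
  have hv' := (measure_ball_lt_top (μ := volume) (x := (0 : RSpace d)) (r := 1)).ne
  have : Nontrivial (RSpace d) := by
    have : Nonempty (Fin d) := ⟨⟨0, hd⟩⟩
    infer_instance
  rw [Measure.addHaar_ball _ _ hr0, finrank_euclideanSpace_fin,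
    ← ENNReal.le_div_iff_mul_le (Or.inl hv) (Or.inl hv')] at h
  have h2 := (ENNReal.ofReal_le_iff_le_toReal (ENNReal.div_ne_top hM hv)).1 h
  exact (le_self_pow₀ hr.le (by omega)).trans h2

/-- The weak type `(1, 1)` bound for the uncentred maximal function. -/
theorem mul_volume_maximalSet_le (hd : 1 ≤ d) (hf : ∫⁻ x, f x ≠ ∞) :
    t * volume (maximalSet f t) ≤ 5 ^ d * ∫⁻ x, f x := by
  rcases eq_or_ne t 0 with rfl | ht
  · simp
  set B : Set (RSpace d × ℝ) := {q | 0 < q.2 ∧ t * volume (Metric.closedBall q.1 q.2) <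
    ∫⁻ z in Metric.closedBall q.1 q.2, f z} with hB
  have hrad : ∀ q ∈ B, q.2 ≤ max 1 ((∫⁻ x, f x) / t /
      volume (Metric.ball (0 : RSpace d) 1)).toReal := by
    rintro ⟨y, r⟩ ⟨hr, h⟩
    refine radius_le hd (x := y) (ENNReal.div_ne_top hf ht) ?_
    rw [ENNReal.le_div_iff_mul_le (Or.inl ht) (Or.inr hf), mul_comm]
    calc t * volume (Metric.ball y r) ≤ t * volume (Metric.closedBall y r) := by
          gcongr
          exact Metric.ball_subset_closedBall
      _ ≤ _ := h.le.trans (setLIntegral_le_lintegral _ _)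
  obtain ⟨u, huB, hdisj, hcov⟩ := Vitali.exists_disjoint_subfamily_covering_enlargement_closedBall
    B (fun q => q.1) (fun q => q.2) _ hrad 5 (by norm_num)
  have hcount : u.Countable := hdisj.countable_of_nonempty_interior fun q hq =>
    ⟨q.1, interior_mono Metric.ball_subset_closedBall (by
      rw [Metric.isOpen_ball.interior_eq]
      exact Metric.mem_ball_self (huB hq).1)⟩
  have hsub : maximalSet f t ⊆ ⋃ q ∈ u, Metric.closedBall q.1 (5 * q.2) := by
    rintro x ⟨y, r, hx, h⟩
    obtain ⟨q, hq, hsub⟩ := hcov (y, r) ⟨Metric.pos_of_mem_ball hx, h⟩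
    exact Set.mem_iUnion₂.2 ⟨q, hq, hsub (Metric.ball_subset_closedBall hx)⟩
  calc t * volume (maximalSet f t)
      ≤ t * ∑' q : u, volume (Metric.closedBall q.1.1 (5 * q.1.2)) := by
        gcongr
        exact (measure_mono hsub).trans (measure_biUnion_le _ hcount _)
    _ = ∑' q : u, 5 ^ d * (t * volume (Metric.closedBall q.1.1 q.1.2)) := by
        rw [← ENNReal.tsum_mul_left]
        refine tsum_congr fun q => ?_
        have hq := (huB q.2).1.le
        rw [Measure.addHaar_closedBall_mul _ _ (by norm_num) hq,
          ← Measure.addHaar_closedBall_center _ q.1.1, finrank_euclideanSpace_fin,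
          ENNReal.ofReal_pow (by norm_num), ENNReal.ofReal_ofNat]
        ring
    _ ≤ ∑' q : u, 5 ^ d * ∫⁻ z in Metric.closedBall q.1.1 q.1.2, f z :=
        ENNReal.tsum_le_tsum fun q => mul_le_mul_right (huB q.2).2.le _
    _ = 5 ^ d * ∫⁻ z in ⋃ q ∈ u, Metric.closedBall q.1 q.2, f z := by
        rw [ENNReal.tsum_mul_left, lintegral_biUnion hcount
          (fun q _ => measurableSet_closedBall) hdisj]
    _ ≤ _ := mul_le_mul_right (setLIntegral_le_lintegral _ _) _

/-- By Lebesgue's differentiation theorem, `f ≤ t` almost everywhere off the maximal set. -/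
theorem ae_le_of_notMem_maximalSet (hm : AEMeasurable f volume) (hf : ∫⁻ x, f x ≠ ∞) :
    ∀ᵐ x, x ∉ maximalSet f t → f x ≤ t := by
  filter_upwards [(Besicovitch.vitaliFamily (volume : Measure (RSpace d))).ae_tendsto_lintegral_div
    hm hf] with x hx hxt
  refine le_of_tendsto (hx.comp (Besicovitch.tendsto_filterAt volume x)) ?_
  filter_upwards [self_mem_nhdsWithin] with r hr
  have hr0 : 0 < r := hr
  exact ENNReal.div_le_of_le_mul
    (lintegral_closedBall_le_of_notMem hxt (Metric.mem_ball_self hr0))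

end maximal

/-! ### Dyadic cubes and Whitney decompositions -/

theorem mem_halfOpenCube {d : ℕ} {a x : RSpace d} {l : ℝ} :
    x ∈ halfOpenCube a l ↔ ∀ i, a i ≤ x i ∧ x i < a i + l := Iff.rfl

theorem halfOpenCube_eq_preimage {d : ℕ} (a : RSpace d) (l : ℝ) :
    halfOpenCube a l = WithLp.ofLp ⁻¹' Set.univ.pi fun i => Set.Ico (a i) (a i + l) := by
  ext x
  simp [mem_halfOpenCube]

theorem measurableSet_halfOpenCube {d : ℕ} (a : RSpace d) (l : ℝ) :
    MeasurableSet (halfOpenCube a l) := by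
  rw [halfOpenCube_eq_preimage]
  exact (PiLp.volume_preserving_ofLp (Fin d)).measurable
    (MeasurableSet.univ_pi fun i => measurableSet_Ico)

theorem volume_halfOpenCube {d : ℕ} (a : RSpace d) (l : ℝ) :
    volume (halfOpenCube a l) = ENNReal.ofReal l ^ d := by
  rw [halfOpenCube_eq_preimage, (PiLp.volume_preserving_ofLp (Fin d)).measure_preimage
    (MeasurableSet.univ_pi fun i => measurableSet_Ico).nullMeasurableSet, Real.volume_pi_Ico]
  simp

theorem norm_le_of_coord {d : ℕ} {x : RSpace d} {r : ℝ} (hr : 0 ≤ r) (h : ∀ i, |x i| ≤ r) :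
    ‖x‖ ≤ d * r := by
  rw [EuclideanSpace.norm_eq]
  refine Real.sqrt_le_iff.2 ⟨by positivity, ?_⟩
  calc ∑ i, ‖x i‖ ^ 2 ≤ ∑ _i : Fin d, r ^ 2 :=
        Finset.sum_le_sum fun i _ => by
          rw [Real.norm_eq_abs]
          exact pow_le_pow_left₀ (abs_nonneg _) (h i) 2
    _ = d * r ^ 2 := by simp
    _ ≤ (d * r) ^ 2 := by
        rw [mul_pow]
        gcongr
        rcases Nat.eq_zero_or_pos d with rfl | hd
        · simp
        · exact le_self_pow₀ (by exact_mod_cast hd) (by norm_num)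

theorem abs_coord_le {d : ℕ} (x : RSpace d) (i : Fin d) : |x i| ≤ ‖x‖ := by
  simpa using PiLp.norm_apply_le x i

theorem isBounded_halfOpenCube {d : ℕ} (a : RSpace d) (l : ℝ) :
    Bornology.IsBounded (halfOpenCube a l) := by
  rcases (halfOpenCube a l).eq_empty_or_nonempty with h | ⟨x, hx⟩
  · rw [h]; exact Bornology.isBounded_empty
  refine (Metric.isBounded_closedBall (x := x) (r := d * |l|)).subset fun y hy => ?_
  rw [Metric.mem_closedBall, dist_eq_norm]
  refine norm_le_of_coord (abs_nonneg _) fun i => ?_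
  have h1 := hx i
  have h2 := hy i
  rw [PiLp.sub_apply]
  exact (abs_le.2 ⟨by linarith, by linarith⟩).trans (le_abs_self l)

/-- Index of a dyadic cube: the scale `k` and the position `m`, for the cube
`2 ^ k (m + [0, 1) ^ d)`. -/
abbrev DyadicIndex (d : ℕ) : Type := ℤ × (Fin d → ℤ)

namespace DyadicIndex

variable {d : ℕ}

/-- The side length of a dyadic cube. -/
noncomputable def side (q : DyadicIndex d) : ℝ := 2 ^ q.1

/-- The dyadic cube with a given index. -/
def cube (q : DyadicIndex d) : Set (RSpace d) := {x | ∀ i, ⌊x i / 2 ^ q.1⌋ = q.2 i}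

/-- The index of the dyadic cube at scale `k` containing `x`. -/
noncomputable def containing (k : ℤ) (x : RSpace d) : DyadicIndex d := (k, fun i => ⌊x i / 2 ^ k⌋)

/-- The index of the dyadic cube of twice the size containing a given one. -/
def parent (q : DyadicIndex d) : DyadicIndex d := (q.1 + 1, fun i => q.2 i / 2)

/-- The concentric enlargement of a dyadic cube by the factor `32 d + 1`. -/
noncomputable def hat (q : DyadicIndex d) : Set (RSpace d) :=
  halfOpenCube (WithLp.toLp 2 fun i => 2 ^ q.1 * (q.2 i : ℝ) - 16 * d * 2 ^ q.1)
    ((32 * d + 1) * 2 ^ q.1)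

theorem side_pos (q : DyadicIndex d) : 0 < q.side := by
  unfold side; positivity

theorem side_parent (q : DyadicIndex d) : q.parent.side = 2 * q.side := by
  simp only [side, parent]
  rw [zpow_add_one₀ (by norm_num), mul_comm]

theorem mem_cube_iff {q : DyadicIndex d} {x : RSpace d} : x ∈ q.cube ↔ containing q.1 x = q := by
  obtain ⟨k, m⟩ := q
  simp only [cube, containing, Set.mem_ofPred_eq, Prod.mk.injEq, true_and]
  exact ⟨fun h => funext h, fun h i => congrFun h i⟩

theorem mem_cube_containing (k : ℤ) (x : RSpace d) : x ∈ (containing k x).cube := fun _ => rfl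

theorem parent_containing (k : ℤ) (x : RSpace d) :
    (containing k x).parent = containing (k + 1) x := by
  simp only [parent, containing, Prod.mk.injEq, true_and]
  funext i
  rw [zpow_add_one₀ (by norm_num), ← div_div]
  exact_mod_cast (Int.floor_div_natCast (x i / 2 ^ k) 2).symm

theorem cube_subset_parent (q : DyadicIndex d) : q.cube ⊆ q.parent.cube := by
  intro x hx
  rw [mem_cube_iff] at hx ⊢
  rw [← hx, parent_containing]
  rfl

theorem mem_cube_iff_coord {q : DyadicIndex d} {x : RSpace d} :
    x ∈ q.cube ↔ ∀ i, q.side * q.2 i ≤ x i ∧ x i < q.side * q.2 i + q.side := by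
  have h0 := q.side_pos
  refine forall_congr' fun i => ?_
  change ⌊x i / q.side⌋ = q.2 i ↔ _
  rw [Int.floor_eq_iff, le_div_iff₀ h0, div_lt_iff₀ h0]
  constructor <;> rintro ⟨h1, h2⟩ <;> constructor <;> linarith

theorem cube_eq (q : DyadicIndex d) :
    q.cube = halfOpenCube (WithLp.toLp 2 fun i => (2 : ℝ) ^ q.1 * (q.2 i : ℝ)) (2 ^ q.1) := by
  ext x
  rw [mem_cube_iff_coord]
  rfl

theorem measurableSet_cube (q : DyadicIndex d) : MeasurableSet q.cube := by
  rw [cube_eq]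
  exact measurableSet_halfOpenCube _ _

theorem isBounded_cube (q : DyadicIndex d) : Bornology.IsBounded q.cube := by
  rw [cube_eq]
  exact isBounded_halfOpenCube _ _

theorem volume_cube (q : DyadicIndex d) : volume q.cube = ENNReal.ofReal (q.side ^ d) := by
  rw [cube_eq, volume_halfOpenCube, ENNReal.ofReal_pow q.side_pos.le]
  rfl

theorem measureReal_cube (q : DyadicIndex d) : volume.real q.cube = q.side ^ d := by
  have := q.side_pos
  rw [measureReal_def, volume_cube, ENNReal.toReal_ofReal (by positivity)]

theorem volume_hat (q : DyadicIndex d) :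
    volume q.hat = ENNReal.ofReal ((32 * d + 1) ^ d * q.side ^ d) := by
  have := q.side_pos
  rw [hat, volume_halfOpenCube, ← ENNReal.ofReal_pow (by positivity), mul_pow]
  rfl

theorem measureReal_hat (q : DyadicIndex d) :
    volume.real q.hat = (32 * d + 1) ^ d * q.side ^ d := by
  have := q.side_pos
  rw [measureReal_def, volume_hat, ENNReal.toReal_ofReal (by positivity)]

theorem measurableSet_hat (q : DyadicIndex d) : MeasurableSet q.hat :=
  measurableSet_halfOpenCube _ _

theorem isBounded_hat (q : DyadicIndex d) : Bornology.IsBounded q.hat :=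
  isBounded_halfOpenCube _ _

theorem isCube_hat (q : DyadicIndex d) : IsCube q.hat :=
  ⟨_, _, by positivity, rfl⟩

theorem nonempty_cube (q : DyadicIndex d) : q.cube.Nonempty := by
  refine ⟨WithLp.toLp 2 fun i => q.side * q.2 i, mem_cube_iff_coord.2 fun i => ?_⟩
  have := q.side_pos
  exact ⟨le_rfl, by simpa using this⟩

theorem norm_sub_le {q : DyadicIndex d} {x y : RSpace d} (hx : x ∈ q.cube) (hy : y ∈ q.cube) :
    ‖x - y‖ ≤ d * q.side := by
  refine norm_le_of_coord q.side_pos.le fun i => ?_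
  have h1 := mem_cube_iff_coord.1 hx i
  have h2 := mem_cube_iff_coord.1 hy i
  rw [PiLp.sub_apply]
  exact abs_le.2 ⟨by linarith, by linarith⟩

theorem mem_hat {q : DyadicIndex d} {x y : RSpace d} (hx : x ∈ q.cube)
    (hy : ‖y - x‖ ≤ 16 * d * q.side) : y ∈ q.hat := by
  intro i
  have h0 := q.side_pos
  have h1 := mem_cube_iff_coord.1 hx i
  have h2 := abs_le.1 ((abs_coord_le (y - x) i).trans hy)
  rw [PiLp.sub_apply] at h2
  change q.side * q.2 i - 16 * d * q.side ≤ y i ∧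
    y i < q.side * q.2 i - 16 * d * q.side + (32 * d + 1) * q.side
  constructor <;> linarith

theorem cube_subset_hat (q : DyadicIndex d) : q.cube ⊆ q.hat := fun x hx =>
  mem_hat hx (by have := q.side_pos; rw [sub_self, norm_zero]; positivity)

theorem cube_subset_of_le {q q' : DyadicIndex d} (h : q.1 ≤ q'.1) {x : RSpace d}
    (hx : x ∈ q.cube) (hx' : x ∈ q'.cube) : q.cube ⊆ q'.cube := by
  have key : ∀ (n : ℕ) (y : RSpace d), y ∈ q.cube →
      containing (q.1 + n) y = containing (q.1 + n) x := by
    intro n y hy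
    induction n with
    | zero =>
      rw [Nat.cast_zero, add_zero, mem_cube_iff.1 hy, mem_cube_iff.1 hx]
    | succ n ih =>
      push_cast
      rw [← add_assoc, ← parent_containing, ih, parent_containing]
  obtain ⟨n, hn⟩ := Int.le.dest h
  intro y hy
  rw [mem_cube_iff] at hx' ⊢
  rw [← hx', ← hn]
  exact key n y hy

theorem hat_injective (hd : 1 ≤ d) : Function.Injective (hat : DyadicIndex d → _) := by
  intro q q' h
  have hv := congrArg volume.real h
  rw [measureReal_hat, measureReal_hat] at hv
  have hs : q.side = q'.side := by
    have h1 : ((32 * d + 1 : ℝ)) ^ d ≠ 0 := by positivity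
    exact (pow_left_inj₀ q.side_pos.le q'.side_pos.le (by omega)).1 (mul_left_cancel₀ h1 hv)
  have hk : q.1 = q'.1 := zpow_right_injective₀ (by norm_num) (by norm_num) hs
  have key : ∀ q q' : DyadicIndex d, q.hat = q'.hat → q.side = q'.side →
      ∀ i, q'.side * q'.2 i ≤ q'.side * q.2 i := by
    intro q q' h hs i
    have h0 := q.side_pos
    have hmem : (WithLp.toLp 2 fun i => 2 ^ q.1 * (q.2 i : ℝ) - 16 * d * 2 ^ q.1 : RSpace d) ∈
        q'.hat := by
      rw [← h]
      intro i
      refine ⟨le_rfl, ?_⟩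
      rw [lt_add_iff_pos_right]
      positivity
    have h2 := (hmem i).1
    change q'.side * q'.2 i - 16 * d * q'.side ≤ q.side * q.2 i - 16 * d * q.side at h2
    rw [hs] at h2
    linarith
  refine Prod.ext hk (funext fun i => ?_)
  have h1 := le_of_mul_le_mul_left (key q q' h hs i) q'.side_pos
  have h2 := le_of_mul_le_mul_left (key q' q h.symm hs.symm i) q.side_pos
  exact_mod_cast le_antisymm h2 h1

/-- The neighbourhood of the cube at distance `4 d` times its side lies in `Ω`. -/
def IsDeep (Ω : Set (RSpace d)) (q : DyadicIndex d) : Prop :=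
  ∀ y ∈ q.cube, Metric.ball y (4 * d * q.side) ⊆ Ω

/-- The Whitney cubes of `Ω`: the maximal dyadic cubes deep inside `Ω`. -/
def whitney (Ω : Set (RSpace d)) : Set (DyadicIndex d) := {q | q.IsDeep Ω ∧ ¬ q.parent.IsDeep Ω}

variable {Ω : Set (RSpace d)}

theorem IsDeep.of_parent {q : DyadicIndex d} (h : q.parent.IsDeep Ω) : q.IsDeep Ω := by
  intro y hy
  refine (Metric.ball_subset_ball ?_).trans (h y (cube_subset_parent q hy))
  rw [side_parent]
  have := q.side_pos
  gcongr
  linarith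

theorem IsDeep.containing_of_le {x : RSpace d} {k k' : ℤ} (hk : k ≤ k')
    (h : (containing k' x).IsDeep Ω) : (containing k x).IsDeep Ω := by
  obtain ⟨n, rfl⟩ := Int.le.dest hk
  clear hk
  induction n with
  | zero => simpa using h
  | succ n ih =>
    refine ih (IsDeep.of_parent ?_)
    rw [parent_containing, add_assoc]
    exact_mod_cast h

theorem eq_of_mem_whitney {q q' : DyadicIndex d} (hq : q ∈ whitney Ω) (hq' : q' ∈ whitney Ω)
    {x : RSpace d} (hx : x ∈ q.cube) (hx' : x ∈ q'.cube) : q = q' := by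
  have key : ∀ q q' : DyadicIndex d, q ∈ whitney Ω → q' ∈ whitney Ω → x ∈ q.cube → x ∈ q'.cube →
      ¬ q.1 < q'.1 := by
    intro q q' hq hq' hx hx' h
    refine hq.2 ?_
    rw [← mem_cube_iff.1 hx, parent_containing]
    refine IsDeep.containing_of_le (k' := q'.1) h ?_
    rw [mem_cube_iff.1 hx']
    exact hq'.1
  have hk : q.1 = q'.1 :=
    le_antisymm (not_lt.1 (key q' q hq' hq hx' hx)) (not_lt.1 (key q q' hq hq' hx hx'))
  rw [← mem_cube_iff.1 hx, ← mem_cube_iff.1 hx', hk]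

theorem exists_mem_whitney (hd : 1 ≤ d) (ho : IsOpen Ω) (hv : volume Ω ≠ ∞) {x : RSpace d}
    (hx : x ∈ Ω) : ∃ q ∈ whitney Ω, x ∈ q.cube := by
  have hd' : (1 : ℝ) ≤ d := by exact_mod_cast hd
  obtain ⟨δ, hδ, hball⟩ := Metric.isOpen_iff.1 ho x hx
  have hex : ∃ k : ℤ, (containing k x).IsDeep Ω := by
    obtain ⟨n, hn⟩ := exists_pow_lt_of_lt_one (show 0 < δ / (5 * d) by positivity)
      (show (2⁻¹ : ℝ) < 1 by norm_num)
    refine ⟨-n, fun y hy => ?_⟩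
    have hside : (containing (-n) x).side = 2⁻¹ ^ n := by
      simp [side, containing]
    have h1 := norm_sub_le hy (mem_cube_containing (-n) x)
    rw [lt_div_iff₀ (by positivity)] at hn
    rw [hside] at h1 ⊢
    refine (Metric.ball_subset_ball' ?_).trans hball
    rw [dist_eq_norm]
    linarith
  have hbdd : ∃ b : ℤ, ∀ k : ℤ, (containing k x).IsDeep Ω → k ≤ b := by
    refine ⟨⌈max 1 (volume Ω / volume (Metric.ball (0 : RSpace d) 1)).toReal⌉, fun k hk => ?_⟩
    have h1 := radius_le hd hv (measure_mono (hk x (mem_cube_containing k x)))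
    have h2 : (k : ℝ) ≤ 2 ^ k := by
      rcases le_or_gt k 0 with h | h
      · exact le_trans (by exact_mod_cast h) (by positivity : (0 : ℝ) ≤ 2 ^ k)
      · lift k to ℕ using h.le
        exact_mod_cast (Nat.lt_two_pow_self (n := k)).le
    have h3 : (2 : ℝ) ^ k ≤ 4 * d * (containing k x).side := by
      change (2 : ℝ) ^ k ≤ 4 * d * 2 ^ k
      exact le_mul_of_one_le_left (by positivity) (by linarith)
    exact_mod_cast (h2.trans (h3.trans h1)).trans (Int.le_ceil _)
  obtain ⟨k, hk, hmax⟩ := Int.exists_greatest_of_bdd hbdd hex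
  refine ⟨containing k x, ⟨hk, fun h => ?_⟩, mem_cube_containing k x⟩
  rw [parent_containing] at h
  have := hmax _ h
  omega

theorem IsDeep.cube_subset (hd : 1 ≤ d) {q : DyadicIndex d} (hq : q.IsDeep Ω) : q.cube ⊆ Ω :=
  fun x hx => hq x hx (Metric.mem_ball_self (by
    have := q.side_pos
    have : (1 : ℝ) ≤ d := by exact_mod_cast hd
    positivity))

theorem IsDeep.le_norm_sub {q : DyadicIndex d} (hq : q.IsDeep Ω) {x y : RSpace d}
    (hx : x ∈ q.cube) (hy : y ∉ Ω) : 4 * d * q.side ≤ ‖x - y‖ := by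
  by_contra h
  refine hy (hq x hx ?_)
  rw [Metric.mem_ball, dist_eq_norm, norm_sub_rev]
  exact not_le.1 h

theorem exists_notMem_of_mem_whitney {q : DyadicIndex d} (hq : q ∈ whitney Ω) {x : RSpace d}
    (hx : x ∈ q.cube) : ∃ z, z ∉ Ω ∧ ‖x - z‖ ≤ 10 * d * q.side := by
  have h := hq.2
  unfold IsDeep at h
  push Not at h
  obtain ⟨y, hy, h⟩ := h
  obtain ⟨z, hz, hzΩ⟩ := Set.not_subset.1 h
  refine ⟨z, hzΩ, ?_⟩
  have h1 := norm_sub_le (cube_subset_parent q hx) hy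
  rw [Metric.mem_ball, dist_eq_norm, norm_sub_rev] at hz
  rw [side_parent] at h1 hz
  have h2 := norm_sub_le_norm_sub_add_norm_sub x y z
  linarith

/-- Two dyadic cubes are near if their distance is less than `2 d` times the larger side. -/
def Near (q q' : DyadicIndex d) : Prop :=
  ∃ x ∈ q.cube, ∃ y ∈ q'.cube, ‖x - y‖ < 2 * d * max q.side q'.side

theorem Near.symm {q q' : DyadicIndex d} (h : Near q q') : Near q' q := by
  obtain ⟨x, hx, y, hy, h⟩ := h
  exact ⟨y, hy, x, hx, by rwa [norm_sub_rev, max_comm]⟩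

theorem Near.side_le (hd : 1 ≤ d) {q q' : DyadicIndex d} (h : Near q q') (hq : q ∈ whitney Ω)
    (hq' : q' ∈ whitney Ω) : q'.side ≤ 5 * q.side := by
  have hd' : (0 : ℝ) < d := by exact_mod_cast hd
  obtain ⟨x, hx, y, hy, h⟩ := h
  rcases le_total q'.side q.side with hs | hs
  · linarith [q.side_pos]
  rw [max_eq_right hs] at h
  obtain ⟨z, hz, hxz⟩ := exists_notMem_of_mem_whitney hq hx
  have h1 := hq'.1.le_norm_sub hy hz
  have h2 := norm_sub_le_norm_sub_add_norm_sub y x z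
  rw [norm_sub_rev y x] at h2
  have h3 : d * (2 * q'.side) ≤ d * (10 * q.side) := by linarith
  linarith [le_of_mul_le_mul_left h3 hd']

theorem Near.cube_subset_hat (hd : 1 ≤ d) {q q' : DyadicIndex d} (h : Near q q')
    (hq : q ∈ whitney Ω) (hq' : q' ∈ whitney Ω) : q'.cube ⊆ q.hat := by
  have hs := h.side_le hd hq hq'
  obtain ⟨x, hx, y, hy, h⟩ := h
  intro w hw
  refine mem_hat hx ?_
  have h1 := norm_sub_le hw hy
  have h2 := norm_sub_le_norm_sub_add_norm_sub w y x
  rw [norm_sub_rev y x] at h2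
  have h3 : max q.side q'.side ≤ 5 * q.side := max_le (by linarith [q.side_pos]) hs
  have hd' : (0 : ℝ) < d := by exact_mod_cast hd
  have h4 : d * max q.side q'.side ≤ d * (5 * q.side) := by gcongr
  have h5 : d * q'.side ≤ d * (5 * q.side) := by gcongr
  have h6 : 0 < d * q.side := mul_pos hd' q.side_pos
  linarith

end DyadicIndex

/-! ### The stopping cubes of a pair of functions -/

namespace DyadicIndex

variable {d : ℕ}

/-- The integral of `|f|` over the enlarged cube. -/
noncomputable def mass (f : RSpace d → ℂ) (q : DyadicIndex d) : ℝ≥0∞ := ∫⁻ x in q.hat, ‖f x‖ₑ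

/-- The stopping threshold: a large multiple of the average of `|f|` over the enlarged cube. -/
noncomputable def threshold (f : RSpace d → ℂ) (q : DyadicIndex d) : ℝ≥0∞ :=
  4 * 5 ^ d * (mass f q / volume q.cube)

/-- The exceptional set, where the maximal function of the restriction of `f` to the enlarged cube
exceeds the threshold. -/
noncomputable def exceptional (f : RSpace d → ℂ) (q : DyadicIndex d) : Set (RSpace d) :=
  maximalSet (q.hat.indicator fun x => ‖f x‖ₑ) (threshold f q)

/-- The union of the exceptional sets of the two functions. -/
noncomputable def stoppingSet (f₁ f₂ : RSpace d → ℂ) (q : DyadicIndex d) : Set (RSpace d) :=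
  exceptional f₁ q ∪ exceptional f₂ q

/-- The stopping cubes inside `q`: the Whitney cubes of the union of the exceptional sets. -/
noncomputable def children (f₁ f₂ : RSpace d → ℂ) (q : DyadicIndex d) : Set (DyadicIndex d) :=
  {p ∈ whitney (stoppingSet f₁ f₂ q) | p.cube ⊆ q.cube}

variable {f f₁ f₂ : RSpace d → ℂ} {q : DyadicIndex d}

theorem lintegral_indicator_hat : ∫⁻ x, q.hat.indicator (fun x => ‖f x‖ₑ) x = mass f q :=
  lintegral_indicator q.measurableSet_hat _

theorem volume_cube_ne_zero (q : DyadicIndex d) : volume q.cube ≠ 0 := by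
  have := q.side_pos
  rw [volume_cube]
  simp only [ne_eq, ENNReal.ofReal_eq_zero, not_le]
  positivity

theorem volume_cube_ne_top (q : DyadicIndex d) : volume q.cube ≠ ∞ :=
  q.isBounded_cube.measure_lt_top.ne

theorem mass_ne_top (hf : IsTest f) : mass f q ≠ ∞ :=
  ne_top_of_le_ne_top hf.integrable.2.ne (setLIntegral_le_lintegral _ _)

theorem threshold_ne_top (hf : IsTest f) : threshold f q ≠ ∞ :=
  ENNReal.mul_ne_top (by finiteness) (ENNReal.div_ne_top (mass_ne_top hf) q.volume_cube_ne_zero)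

theorem volume_exceptional_le (hd : 1 ≤ d) (hf : IsTest f) :
    volume (exceptional f q) ≤ volume q.cube / 4 := by
  have hm := mass_ne_top (q := q) hf
  rcases eq_or_ne (mass f q) 0 with h0 | h0
  · have : exceptional f q = ∅ := by
      refine Set.eq_empty_of_forall_notMem ?_
      rintro x ⟨y, r, -, h⟩
      have h2 := (setLIntegral_le_lintegral (Metric.closedBall y r)
        (q.hat.indicator fun x => ‖f x‖ₑ)).trans_eq (lintegral_indicator_hat.trans h0)
      exact absurd (h.trans_le h2) (by simp)
    simp [this]
  · have h := mul_volume_maximalSet_le (t := threshold f q) hd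
      (lintegral_indicator_hat (f := f) (q := q) ▸ hm)
    rw [lintegral_indicator_hat] at h
    have e : threshold f q * volume (exceptional f q) =
        (5 ^ d * mass f q) * (4 * volume (exceptional f q) / volume q.cube) := by
      rw [threshold]
      simp only [div_eq_mul_inv]
      ring
    change threshold f q * volume (exceptional f q) ≤ _ at h
    rw [e] at h
    have h1 : (5 ^ d * mass f q) ≠ 0 := mul_ne_zero (by positivity) h0
    have h2 : (5 ^ d * mass f q) ≠ ∞ := ENNReal.mul_ne_top (by finiteness) hm
    have h3 : 4 * volume (exceptional f q) / volume q.cube ≤ 1 := by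
      rw [← ENNReal.mul_le_mul_iff_right h1 h2]
      simpa using h
    rw [ENNReal.div_le_iff q.volume_cube_ne_zero q.volume_cube_ne_top, one_mul] at h3
    rw [ENNReal.le_div_iff_mul_le (by simp) (by simp), mul_comm]
    exact h3

theorem isOpen_stoppingSet : IsOpen (stoppingSet f₁ f₂ q) :=
  isOpen_maximalSet.union isOpen_maximalSet

theorem volume_stoppingSet_le (hd : 1 ≤ d) (hf₁ : IsTest f₁) (hf₂ : IsTest f₂) :
    volume (stoppingSet f₁ f₂ q) ≤ volume q.cube / 2 := by
  refine (measure_union_le _ _).trans ((add_le_add (volume_exceptional_le hd hf₁)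
    (volume_exceptional_le hd hf₂)).trans_eq ?_)
  rw [← ENNReal.toReal_eq_toReal_iff' (by have := q.volume_cube_ne_top; finiteness)
    (by have := q.volume_cube_ne_top; finiteness)]
  rw [ENNReal.toReal_add (by have := q.volume_cube_ne_top; finiteness)
    (by have := q.volume_cube_ne_top; finiteness)]
  simp only [ENNReal.toReal_div, ENNReal.toReal_ofNat]
  ring

theorem volume_stoppingSet_lt (hd : 1 ≤ d) (hf₁ : IsTest f₁) (hf₂ : IsTest f₂) :
    volume (stoppingSet f₁ f₂ q) < volume q.cube :=
  (volume_stoppingSet_le hd hf₁ hf₂).trans_lt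
    (ENNReal.half_lt_self q.volume_cube_ne_zero q.volume_cube_ne_top)

theorem volume_stoppingSet_ne_top (hd : 1 ≤ d) (hf₁ : IsTest f₁) (hf₂ : IsTest f₂) :
    volume (stoppingSet f₁ f₂ q) ≠ ∞ :=
  ((volume_stoppingSet_lt hd hf₁ hf₂).trans_le le_top).ne

/-- A Whitney cube meeting `q` is one of its stopping cubes, as the exceptional set is too small to
contain `q`. -/
theorem mem_children_of_mem (hd : 1 ≤ d) (hf₁ : IsTest f₁) (hf₂ : IsTest f₂) {p : DyadicIndex d}
    (hp : p ∈ whitney (stoppingSet f₁ f₂ q)) {x : RSpace d} (hx : x ∈ p.cube) (hxq : x ∈ q.cube) :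
    p ∈ children f₁ f₂ q := by
  refine ⟨hp, cube_subset_of_le (not_lt.1 fun h => ?_) hx hxq⟩
  have hsub : q.cube ⊆ stoppingSet f₁ f₂ q :=
    (cube_subset_of_le h.le hxq hx).trans (hp.1.cube_subset hd)
  exact absurd (measure_mono hsub) (not_le.2 (volume_stoppingSet_lt hd hf₁ hf₂))

theorem biUnion_children_subset (hd : 1 ≤ d) :
    ⋃ p ∈ children f₁ f₂ q, p.cube ⊆ stoppingSet f₁ f₂ q :=
  Set.iUnion₂_subset fun _ hp => hp.1.1.cube_subset hd

theorem disjoint_of_mem_whitney {Ω : Set (RSpace d)} {p p' : DyadicIndex d} (hp : p ∈ whitney Ω)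
    (hp' : p' ∈ whitney Ω) (h : p ≠ p') : Disjoint p.cube p'.cube := by
  rw [Set.disjoint_left]
  exact fun x hx hx' => h (eq_of_mem_whitney hp hp' hx hx')

theorem tsum_volume_whitney_le (hd : 1 ≤ d) (Ω : Set (RSpace d)) :
    ∑' p : whitney Ω, volume p.1.cube ≤ volume Ω := by
  rw [← measure_iUnion (fun p p' h => disjoint_of_mem_whitney p.2 p'.2
    fun h' => h (Subtype.ext h')) fun p => p.1.measurableSet_cube]
  exact measure_mono (Set.iUnion_subset fun p => p.2.1.cube_subset hd)

theorem tsum_volume_children_le (hd : 1 ≤ d) (hf₁ : IsTest f₁) (hf₂ : IsTest f₂) :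
    ∑' p : children f₁ f₂ q, volume p.1.cube ≤ volume q.cube / 2 := by
  rw [← measure_iUnion (fun p p' h => disjoint_of_mem_whitney p.2.1 p'.2.1
    fun h' => h (Subtype.ext h')) fun p => p.1.measurableSet_cube]
  exact (measure_mono (Set.iUnion_subset fun p => p.2.1.1.cube_subset hd)).trans
    (volume_stoppingSet_le hd hf₁ hf₂)

/-! ### The recursive inequality for the localized forms -/

/-- The localized form at `q`: the largest value of the form on restrictions of `f₁` to subsets of
the cube and of `f₂` to subsets of the enlarged cube. Taking all subsets makes the quantity stable
under the restrictions produced by the decomposition. -/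
noncomputable def localForm (T : L2Space d →L[ℂ] L2Space d) (f₁ f₂ : RSpace d → ℂ)
    (q : DyadicIndex d) : ℝ≥0∞ :=
  ⨆ (A : Set (RSpace d)) (B : Set (RSpace d)) (_ : MeasurableSet A ∧ A ⊆ q.cube)
    (_ : MeasurableSet B ∧ B ⊆ q.hat), ‖bilin T (A.indicator f₁) (B.indicator f₂)‖ₑ

theorem le_localForm (T : L2Space d →L[ℂ] L2Space d) {A B : Set (RSpace d)}
    (hA : MeasurableSet A) (hAq : A ⊆ q.cube) (hB : MeasurableSet B) (hBq : B ⊆ q.hat) :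
    ‖bilin T (A.indicator f₁) (B.indicator f₂)‖ₑ ≤ localForm T f₁ f₂ q := by
  unfold localForm
  exact le_iSup₂_of_le A B (le_iSup₂_of_le ⟨hA, hAq⟩ ⟨hB, hBq⟩ le_rfl)

theorem localForm_le {T : L2Space d →L[ℂ] L2Space d} {b : ℝ≥0∞}
    (h : ∀ A B : Set (RSpace d), MeasurableSet A → A ⊆ q.cube → MeasurableSet B → B ⊆ q.hat →
      ‖bilin T (A.indicator f₁) (B.indicator f₂)‖ₑ ≤ b) : localForm T f₁ f₂ q ≤ b :=
  iSup₂_le fun A B => iSup₂_le fun hA hB => h A B hA.1 hA.2 hB.1 hB.2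

/-- The summand of the sparse form for the enlarged cube of `q`. -/
noncomputable def sparseTerm (f₁ f₂ : RSpace d → ℂ) (q : DyadicIndex d) : ℝ :=
  (mass f₁ q).toReal * (mass f₂ q).toReal / volume.real q.hat

theorem isSeparatedFamily_whitney (hd : 1 ≤ d) {Ω : Set (RSpace d)} (F : Finset (whitney Ω)) :
    IsSeparatedFamily F (fun p => p.1.cube) (fun p => 2 * d * p.1.side)
      (fun p p' => Near p.1 p'.1) ((2 * d : ℝ)⁻¹ ^ d) ((32 * d + 1) ^ d) := by
  have hd' : (0 : ℝ) < d := by exact_mod_cast hd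
  refine ⟨fun p _ => p.1.measurableSet_cube, fun p _ => p.1.isBounded_cube,
    fun p _ => p.1.nonempty_cube, fun p _ p' _ h => disjoint_of_mem_whitney p.2 p'.2
      fun h' => h (Subtype.ext h'), fun p _ => ?_, fun p _ x hx y hy => ?_, fun p _ => ?_,
    fun p p' h => h.symm, fun p _ p' _ h x hx y hy => ?_, fun p _ => ?_⟩
  · have := p.1.side_pos
    positivity
  · linarith [norm_sub_le hx hy]
  · rw [measureReal_cube, ← mul_pow, inv_mul_cancel_left₀ (by positivity)]
  · by_contra hlt
    refine h ⟨x, hx, y, hy, (not_le.1 hlt).trans_le ?_⟩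
    gcongr
    exact le_max_left _ _
  · rw [measureReal_cube, ← measureReal_hat]
    refine measureReal_mono ?_ p.1.isBounded_hat.measure_lt_top.ne
    exact Set.iUnion₂_subset fun p' _ => Set.iUnion_subset fun h => h.cube_subset_hat hd p.2 p'.2

/-- The dimensional factor between the threshold and the bound in `IsControlled`. -/
noncomputable def controlConst (d : ℕ) : ℝ :=
  1 + 6 ^ d * volume.real (Metric.ball (0 : RSpace d) 1)

theorem isControlled_whitney (hd : 1 ≤ d) (hf : IsTest f) {Ω A : Set (RSpace d)}
    (hΩ : MeasurableSet Ω)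
    (hfΩ : exceptional f q ⊆ Ω) (hA : MeasurableSet A) (hAq : A ⊆ q.hat) (F : Finset (whitney Ω)) :
    IsControlled F (fun p => p.1.cube) (fun p => 2 * d * p.1.side) (q.hat ∪ Ω)
      ((A ∩ (Ωᶜ ∪ ⋃ p ∈ F, p.1.cube)).indicator f)
      ((threshold f q).toReal * controlConst d) := by
  have hd' : (0 : ℝ) < d := by exact_mod_cast hd
  have ht := threshold_ne_top (q := q) hf
  set G : Set (RSpace d) := A ∩ (Ωᶜ ∪ ⋃ p ∈ F, p.1.cube)
  have hG : MeasurableSet G := hA.inter (hΩ.compl.union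
    (Finset.measurableSet_biUnion _ fun p _ => p.1.measurableSet_cube))
  have hv : 0 ≤ volume.real (Metric.ball (0 : RSpace d) 1) := measureReal_nonneg
  have hC : 1 ≤ controlConst d := by
    rw [controlConst, le_add_iff_nonneg_right]
    positivity
  have hout : ∀ y, (∀ p ∈ F, y ∉ p.1.cube) → G.indicator f y ≠ 0 →
      y ∉ Ω ∧ y ∈ q.hat := by
    intro y hy hne
    have hyG : y ∈ G := Set.mem_of_indicator_ne_zero hne
    refine ⟨?_, hAq hyG.1⟩
    rcases hyG.2 with h | h
    · exact h
    · obtain ⟨p, hp, hyp⟩ := Set.mem_iUnion₂.1 h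
      exact absurd hyp (hy p hp)
  have hle : ∀ x, ‖G.indicator f x‖ₑ ≤ q.hat.indicator (fun x => ‖f x‖ₑ) x := by
    intro x
    by_cases hx : x ∈ G
    · rw [Set.indicator_of_mem hx, Set.indicator_of_mem (hAq hx.1)]
    · rw [Set.indicator_of_notMem hx]
      simp
  refine ⟨hf.indicator hG, by positivity, ?_, ?_, ?_, ?_⟩
  · exact fun x hx => Or.inl (hAq (Set.mem_of_indicator_ne_zero hx).1)
  · have hae := ae_le_of_notMem_maximalSet (f := q.hat.indicator fun x => ‖f x‖ₑ)
      (t := threshold f q) (hf.memLp_top.1.enorm.indicator q.measurableSet_hat)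
      (lintegral_indicator_hat (f := f) (q := q) ▸ mass_ne_top hf)
    filter_upwards [hae] with x hx hxF
    by_cases h0 : G.indicator f x = 0
    · rw [h0, norm_zero]
      positivity
    · have h1 := hout x hxF h0
      have h2 := (hle x).trans (hx fun h => h1.1 (hfΩ h))
      rw [← ofReal_norm, ENNReal.ofReal_le_iff_le_toReal ht] at h2
      exact h2.trans (le_mul_of_one_le_right ENNReal.toReal_nonneg hC)
  · intro p _ x hx r hr
    obtain ⟨z, hz, hxz⟩ := exists_notMem_of_mem_whitney p.2 hx
    have hs := p.1.side_pos
    have hr0 : 0 < r := lt_of_lt_of_le (by positivity) hr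
    -- The ball of radius `6 r` reaches a point off the exceptional set, where averages are small.
    have hzball : z ∈ Metric.ball x (6 * r) := by
      rw [Metric.mem_ball, dist_eq_norm, norm_sub_rev]
      linarith
    calc ∫⁻ y in Metric.ball x r, ‖G.indicator f y‖ₑ
        ≤ ∫⁻ y in Metric.closedBall x (6 * r), q.hat.indicator (fun x => ‖f x‖ₑ) y :=
          (lintegral_mono hle).trans (lintegral_mono_set (Metric.ball_subset_closedBall.trans
            (Metric.closedBall_subset_closedBall (by linarith))))
      _ ≤ threshold f q * volume (Metric.closedBall x (6 * r)) :=
          lintegral_closedBall_le_of_notMem (fun h => hz (hfΩ h)) hzball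
      _ = ENNReal.ofReal ((threshold f q).toReal *
            (6 ^ d * volume.real (Metric.ball (0 : RSpace d) 1)) * r ^ d) := by
          rw [Measure.addHaar_closedBall _ _ (by positivity), finrank_euclideanSpace_fin,
            ← ofReal_measureReal (s := Metric.ball 0 1) measure_ball_lt_top.ne]
          nth_rw 1 [← ENNReal.ofReal_toReal ht]
          rw [← ENNReal.ofReal_mul (by positivity), ← ENNReal.ofReal_mul (by positivity)]
          congr 1
          ring
      _ ≤ _ := by
          refine ENNReal.ofReal_le_ofReal ?_
          gcongr
          exact le_add_of_nonneg_left zero_le_one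
  · intro p _ x hx y hy hne
    have := p.2.1.le_norm_sub hx (hout y hy hne).1
    have hs := mul_pos hd' p.1.side_pos
    linarith

/-- The dimensional constant in the recursive inequality. -/
noncomputable def stepConst (d : ℕ) : ℝ :=
  (2 ^ (d + 2) * (1 + volume.real (Metric.ball (0 : RSpace d) 1)) + 1 + (32 * d + 1) ^ d) /
    ((2 * d : ℝ)⁻¹ ^ d) ^ 2 *
    ((4 * 5 ^ d * controlConst d) ^ 2 * (2 * ((32 * d + 1) ^ d) ^ 2))

variable {T : L2Space d →L[ℂ] L2Space d} {K : RSpace d → RSpace d → ℂ} {c : ℝ} {ω : ℝ → ℝ}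

theorem sparseTerm_nonneg : 0 ≤ sparseTerm f₁ f₂ q := by
  unfold sparseTerm
  positivity

theorem toReal_threshold : (threshold f q).toReal =
    4 * 5 ^ d * ((mass f q).toReal / volume.real q.cube) := by
  simp [threshold, ENNReal.toReal_mul, ENNReal.toReal_div, measureReal_def]

/-- The decomposition step at scale `q`, with finitely many Whitney cubes retained. -/
theorem norm_bilin_sub_sum_whitney_le (hd : 1 ≤ d) (hT : IsDiniCZO T K c ω)
    (hf₁ : IsTest f₁) (hf₂ : IsTest f₂) {A B : Set (RSpace d)} (hA : MeasurableSet A)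
    (hAq : A ⊆ q.cube) (hB : MeasurableSet B) (hBq : B ⊆ q.hat)
    (F : Finset (whitney (stoppingSet f₁ f₂ q))) {G : Set (RSpace d)}
    (hG : G = (stoppingSet f₁ f₂ q)ᶜ ∪ ⋃ p ∈ F, p.1.cube) :
    ‖bilin T ((A ∩ G).indicator f₁) ((B ∩ G).indicator f₂) -
      ∑ p ∈ F, bilin T (p.1.cube.indicator ((A ∩ G).indicator f₁))
        ((nearUnion F (fun p => p.1.cube) (fun p p' => Near p.1 p'.1) p).indicator
          ((B ∩ G).indicator f₂))‖ ≤
      stepConst d * (‖T‖ + c * ∫ t in Set.Ioc (0 : ℝ) 1, ω t / t) * sparseTerm f₁ f₂ q := by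
  subst hG
  have hd' : (1 : ℝ) ≤ d := by exact_mod_cast hd
  have hc := hT.const_nonneg hd
  have hI := hT.modulus.dini_nonneg
  have hΩ := (isOpen_stoppingSet (f₁ := f₁) (f₂ := f₂) (q := q)).measurableSet
  have hs := q.side_pos
  have hX : volume (q.hat ∪ stoppingSet f₁ f₂ q) ≠ ∞ :=
    measure_union_ne_top q.isBounded_hat.measure_lt_top.ne (volume_stoppingSet_ne_top hd hf₁ hf₂)
  have hγ : (0 : ℝ) < (2 * d : ℝ)⁻¹ ^ d := by positivity
  have hκ : (1 : ℝ) ≤ (32 * d + 1) ^ d := one_le_pow₀ (by linarith)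
  refine ((isSeparatedFamily_whitney hd F).norm_bilin_sub_sum_le hd hT hγ
    (pow_le_one₀ (by positivity) (inv_le_one_of_one_le₀ (by linarith)))
    hκ hX
    (fun p _ => (p.2.1.cube_subset hd).trans Set.subset_union_right)
    (isControlled_whitney hd hf₁ hΩ Set.subset_union_left hA (hAq.trans (cube_subset_hat q)) F)
    (isControlled_whitney hd hf₂ hΩ Set.subset_union_right hB hBq F)).trans ?_
  have hXle : volume.real (q.hat ∪ stoppingSet f₁ f₂ q) ≤
      2 * (32 * d + 1) ^ d * volume.real q.cube := by
    refine (measureReal_union_le _ _).trans ?_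
    have h1 : volume.real (stoppingSet f₁ f₂ q) ≤ volume.real q.cube :=
      ENNReal.toReal_mono q.volume_cube_ne_top (volume_stoppingSet_lt hd hf₁ hf₂).le
    rw [measureReal_hat, ← measureReal_cube]
    have h2 : 0 ≤ volume.real q.cube := measureReal_nonneg
    nlinarith
  have hC : 0 ≤ controlConst d := by unfold controlConst; positivity
  calc _ ≤ (2 ^ (d + 2) * (1 + volume.real (Metric.ball (0 : RSpace d) 1)) + 1 +
          (32 * d + 1) ^ d) / ((2 * d : ℝ)⁻¹ ^ d) ^ 2 *
          (‖T‖ + c * ∫ t in Set.Ioc (0 : ℝ) 1, ω t / t) *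
          ((threshold f₁ q).toReal * controlConst d * ((threshold f₂ q).toReal * controlConst d) *
            (2 * (32 * d + 1) ^ d * volume.real q.cube)) := by gcongr
    _ = _ := by
        have h0 : volume.real q.cube ≠ 0 := by
          rw [measureReal_cube]
          positivity
        have h1 : volume.real q.hat = (32 * d + 1) ^ d * volume.real q.cube := by
          rw [measureReal_hat, measureReal_cube]
        rw [toReal_threshold, toReal_threshold, stepConst, sparseTerm, h1]
        have h2 : ((32 * d + 1 : ℝ)) ^ d ≠ 0 := by positivity
        field_simp

theorem enorm_bilin_whitney_le (hd : 1 ≤ d) (hT : IsDiniCZO T K c ω)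
    (hf₁ : IsTest f₁) (hf₂ : IsTest f₂) {A B : Set (RSpace d)} (hA : MeasurableSet A)
    (hAq : A ⊆ q.cube) (hB : MeasurableSet B) (hBq : B ⊆ q.hat)
    (F : Finset (whitney (stoppingSet f₁ f₂ q))) {G : Set (RSpace d)}
    (hG : G = (stoppingSet f₁ f₂ q)ᶜ ∪ ⋃ p ∈ F, p.1.cube) :
    ‖bilin T ((A ∩ G).indicator f₁) ((B ∩ G).indicator f₂)‖ₑ ≤
      ENNReal.ofReal (stepConst d * (‖T‖ + c * ∫ t in Set.Ioc (0 : ℝ) 1, ω t / t) *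
        sparseTerm f₁ f₂ q) + ∑' p : children f₁ f₂ q, localForm T f₁ f₂ p.1 := by
  have hGm : MeasurableSet G := by
    rw [hG]
    exact isOpen_stoppingSet.measurableSet.compl.union
      (Finset.measurableSet_biUnion _ fun p _ => p.1.measurableSet_cube)
  have h := norm_bilin_sub_sum_whitney_le hd hT hf₁ hf₂ hA hAq hB hBq F hG
  set S := ∑ p ∈ F, bilin T (p.1.cube.indicator ((A ∩ G).indicator f₁))
    ((nearUnion F (fun p => p.1.cube) (fun p p' => Near p.1 p'.1) p).indicator
      ((B ∩ G).indicator f₂)) with hS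
  have h1 : ‖S‖ₑ ≤ ∑' p : children f₁ f₂ q, localForm T f₁ f₂ p.1 := by
    calc ‖S‖ₑ ≤ ∑ p ∈ F, (children f₁ f₂ q).indicator (localForm T f₁ f₂) p.1 := by
          refine (enorm_sum_le _ _).trans (Finset.sum_le_sum fun p _ => ?_)
          have hsepF := isSeparatedFamily_whitney hd F
          rw [Set.indicator_indicator, Set.indicator_indicator]
          by_cases hp : p.1 ∈ children f₁ f₂ q
          · rw [Set.indicator_of_mem hp]
            refine le_localForm T (p.1.measurableSet_cube.inter (hA.inter hGm))
              Set.inter_subset_left ((hsepF.measurableSet_nearUnion p).inter (hB.inter hGm))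
              (Set.inter_subset_left.trans ?_)
            exact Set.iUnion₂_subset fun p' _ => Set.iUnion_subset fun h =>
              h.cube_subset_hat hd p.2 p'.2
          · have hempty : p.1.cube ∩ (A ∩ G) = ∅ := by
              refine Set.eq_empty_of_forall_notMem fun x hx => hp ?_
              exact mem_children_of_mem hd hf₁ hf₂ p.2 hx.1 (hAq hx.2.1)
            have h0 : (∅ : Set (RSpace d)).indicator f₁ = 0 := Set.indicator_empty f₁
            rw [hempty, h0, bilin_zero_left T
              (hf₂.indicator ((hsepF.measurableSet_nearUnion p).inter (hB.inter hGm)))]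
            simp
      _ ≤ ∑' p : whitney (stoppingSet f₁ f₂ q),
            (children f₁ f₂ q).indicator (localForm T f₁ f₂) p.1 := ENNReal.sum_le_tsum F
      _ ≤ ∑' p, (children f₁ f₂ q).indicator (localForm T f₁ f₂) p :=
          ENNReal.tsum_comp_le_tsum_of_injective Subtype.val_injective _
      _ = _ := (tsum_subtype _ _).symm
  calc _ = ‖(bilin T ((A ∩ G).indicator f₁) ((B ∩ G).indicator f₂) - S) + S‖ₑ := by
        rw [sub_add_cancel]
    _ ≤ _ := (enorm_add_le _ _).trans (add_le_add ?_ h1)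
  rw [← ofReal_norm]
  exact ENNReal.ofReal_le_ofReal h

theorem exists_bound (hf : IsTest f) : ∃ a : ℝ, 0 ≤ a ∧ ∀ᵐ x, ‖f x‖ ≤ a := by
  refine ⟨(eLpNorm f ∞ volume).toReal, ENNReal.toReal_nonneg, ?_⟩
  have h := hf.memLp_top.2.ne
  rw [eLpNorm_exponent_top] at h ⊢
  filter_upwards [enorm_ae_le_eLpNormEssSup f volume] with x hx
  rw [← toReal_enorm]
  exact ENNReal.toReal_mono h hx

/-- The recursive inequality: the localized form at `q` is bounded by the sparse term of `q` plus
the localized forms at the stopping cubes. It follows from the decomposition with finitely many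
Whitney cubes retained, as the part of the exceptional set which is left out has arbitrarily small
measure. -/
theorem localForm_le_add_tsum (hd : 1 ≤ d) (hT : IsDiniCZO T K c ω)
    (hf₁ : IsTest f₁) (hf₂ : IsTest f₂) :
    localForm T f₁ f₂ q ≤
      ENNReal.ofReal (stepConst d * (‖T‖ + c * ∫ t in Set.Ioc (0 : ℝ) 1, ω t / t) *
        sparseTerm f₁ f₂ q) + ∑' p : children f₁ f₂ q, localForm T f₁ f₂ p.1 := by
  refine localForm_le fun A B hA hAq hB hBq => ?_
  set R := ENNReal.ofReal (stepConst d * (‖T‖ + c * ∫ t in Set.Ioc (0 : ℝ) 1, ω t / t) *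
        sparseTerm f₁ f₂ q) + ∑' p : children f₁ f₂ q, localForm T f₁ f₂ p.1
  set Ω := stoppingSet f₁ f₂ q
  have hΩ : IsOpen Ω := isOpen_stoppingSet
  have hΩtop : volume Ω ≠ ∞ := volume_stoppingSet_ne_top hd hf₁ hf₂
  obtain ⟨a, ha0, ha⟩ := exists_bound hf₁
  obtain ⟨b, hb0, hb⟩ := exists_bound hf₂
  set e : Finset (whitney Ω) → ℝ≥0∞ := fun F => ∑' p : {p // p ∉ F}, volume p.1.1.cube
  have he : Filter.Tendsto e Filter.atTop (nhds 0) :=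
    ENNReal.tendsto_tsum_compl_atTop_zero
      (ne_top_of_le_ne_top hΩtop (tsum_volume_whitney_le hd Ω))
  set Y := volume q.hat ^ (1 / 2 : ℝ)
  have hY : Y ≠ ∞ := by
    have : volume q.hat ≠ ∞ := q.isBounded_hat.measure_lt_top.ne
    finiteness
  set C := ‖T‖ₑ * ENNReal.ofReal a * (Y * ENNReal.ofReal b) with hC
  have hCtop : 2 * C ≠ ∞ := by finiteness
  have key : ∀ F, ‖bilin T (A.indicator f₁) (B.indicator f₂)‖ₑ ≤
      R + 2 * C * e F ^ (1 / 2 : ℝ) := by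
    intro F
    set G : Set (RSpace d) := Ωᶜ ∪ ⋃ p ∈ F, p.1.cube with hG
    have hGm : MeasurableSet G := hΩ.measurableSet.compl.union
      (Finset.measurableSet_biUnion _ fun p _ => p.1.measurableSet_cube)
    have hGe : volume Gᶜ ≤ e F := by
      have hsub : Gᶜ ⊆ ⋃ p : {p // p ∉ F}, p.1.1.cube := by
        intro x hx
        have hxΩ : x ∈ Ω := by
          by_contra h
          exact hx (Or.inl h)
        obtain ⟨p, hp, hxp⟩ := exists_mem_whitney hd hΩ hΩtop hxΩ
        refine Set.mem_iUnion.2 ⟨⟨⟨p, hp⟩, fun hF => hx (Or.inr ?_)⟩, hxp⟩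
        exact Set.mem_iUnion₂.2 ⟨⟨p, hp⟩, hF, hxp⟩
      exact (measure_mono hsub).trans (measure_iUnion_le _)
    have hsplit : ∀ (E : Set (RSpace d)) (f : RSpace d → ℂ),
        E.indicator f = (E ∩ G).indicator f + (E ∩ Gᶜ).indicator f := by
      intro E f
      ext x
      by_cases hE : x ∈ E <;> by_cases hG : x ∈ G <;> simp [hE, hG]
    have tA := hf₁.indicator (hA.inter hGm)
    have tA' := hf₁.indicator (hA.inter hGm.compl)
    have tB := hf₂.indicator (hB.inter hGm)
    have tB' := hf₂.indicator (hB.inter hGm.compl)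
    have tBall := hf₂.indicator hB
    rw [hsplit A f₁, bilin_add_left T tA tA' tBall]
    nth_rw 1 [hsplit B f₂]
    rw [bilin_add_right T tA tB tB']
    have b1 := enorm_bilin_whitney_le hd hT hf₁ hf₂ hA hAq hB hBq F hG
    have hAhat : A ⊆ q.hat := hAq.trans (cube_subset_hat q)
    have b2 : ‖bilin T ((A ∩ G).indicator f₁) ((B ∩ Gᶜ).indicator f₂)‖ₑ ≤
        C * e F ^ (1 / 2 : ℝ) := by
      refine (enorm_bilin_le_of_support T tA tB' (ae_norm_indicator_le _ ha)
        (ae_norm_indicator_le _ hb)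
        (Set.support_indicator_subset.trans (Set.inter_subset_left.trans hAhat))
        (Set.support_indicator_subset.trans Set.inter_subset_right)).trans ?_
      calc _ ≤ ‖T‖ₑ * (Y * ENNReal.ofReal a) * (e F ^ (1 / 2 : ℝ) * ENNReal.ofReal b) := by
            gcongr
        _ = _ := by rw [hC]; ring
    have b3 : ‖bilin T ((A ∩ Gᶜ).indicator f₁) (B.indicator f₂)‖ₑ ≤ C * e F ^ (1 / 2 : ℝ) := by
      refine (enorm_bilin_le_of_support T tA' tBall (ae_norm_indicator_le _ ha)
        (ae_norm_indicator_le _ hb)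
        (Set.support_indicator_subset.trans Set.inter_subset_right)
        (Set.support_indicator_subset.trans hBq)).trans ?_
      calc _ ≤ ‖T‖ₑ * (e F ^ (1 / 2 : ℝ) * ENNReal.ofReal a) * (Y * ENNReal.ofReal b) := by
            gcongr
        _ = _ := by rw [hC]; ring
    calc _ ≤ R + C * e F ^ (1 / 2 : ℝ) + C * e F ^ (1 / 2 : ℝ) :=
          (enorm_add_le _ _).trans (add_le_add ((enorm_add_le _ _).trans (add_le_add b1 b2)) b3)
      _ = _ := by ring
  have hlim : Filter.Tendsto (fun F => R + 2 * C * e F ^ (1 / 2 : ℝ)) Filter.atTop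
      (nhds (R + 2 * C * 0 ^ (1 / 2 : ℝ))) :=
    tendsto_const_nhds.add (ENNReal.Tendsto.const_mul
      ((ENNReal.continuous_rpow_const.tendsto 0).comp he) (Or.inr hCtop))
  rw [ENNReal.zero_rpow_of_pos (by norm_num), mul_zero, add_zero] at hlim
  exact ge_of_tendsto' hlim key

/-- The trivial bound for the localized form, from the boundedness of the functions. -/
theorem exists_localForm_le (T : L2Space d →L[ℂ] L2Space d) (hf₁ : IsTest f₁) (hf₂ : IsTest f₂) :
    ∃ M : ℝ≥0∞, M ≠ ∞ ∧ ∀ q : DyadicIndex d, localForm T f₁ f₂ q ≤ M * volume q.cube := by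
  obtain ⟨a, ha0, ha⟩ := exists_bound hf₁
  obtain ⟨b, hb0, hb⟩ := exists_bound hf₂
  refine ⟨ENNReal.ofReal (‖T‖ * a * b * (32 * d + 1) ^ d), ENNReal.ofReal_ne_top, fun q => ?_⟩
  refine localForm_le fun A B hA hAq hB hBq => ?_
  have h := norm_bilin_le T (hf₁.indicator hA) (hf₂.indicator hB) ha0 hb0
    q.isBounded_hat.measure_lt_top.ne q.isBounded_hat.measure_lt_top.ne
    (ae_norm_indicator_le _ ha) (ae_norm_indicator_le _ hb)
    (Set.support_indicator_subset.trans (hAq.trans (cube_subset_hat q)))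
    (Set.support_indicator_subset.trans hBq)
  rw [Real.sqrt_mul_self measureReal_nonneg, measureReal_hat, ← mul_assoc] at h
  rw [← ofReal_norm, volume_cube, ← ENNReal.ofReal_mul (by positivity)]
  exact ENNReal.ofReal_le_ofReal h

end DyadicIndex

/-! ### Iterating the stopping procedure -/

namespace DyadicIndex

variable {d : ℕ} {f₁ f₂ : RSpace d → ℂ} {q p r : DyadicIndex d}

/-- All cubes obtained from `q` by iterating the passage to stopping cubes, `q` included. -/
def descendants (f₁ f₂ : RSpace d → ℂ) (q : DyadicIndex d) : Set (DyadicIndex d) :=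
  {r | Relation.ReflTransGen (fun a b => b ∈ children f₁ f₂ a) q r}

theorem self_mem_descendants : q ∈ descendants f₁ f₂ q := Relation.ReflTransGen.refl

theorem descendants_subset (hp : p ∈ children f₁ f₂ q) :
    descendants f₁ f₂ p ⊆ descendants f₁ f₂ q :=
  fun _ hr => Relation.ReflTransGen.head hp hr

theorem cube_subset_of_mem_descendants (hr : r ∈ descendants f₁ f₂ q) : r.cube ⊆ q.cube := by
  induction hr with
  | refl => exact le_rfl
  | tail _ h ih => exact h.2.trans ih

theorem eq_of_mem_children {x : RSpace d} {p' : DyadicIndex d} (hp : p ∈ children f₁ f₂ q)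
    (hp' : p' ∈ children f₁ f₂ q) (hx : x ∈ p.cube) (hx' : x ∈ p'.cube) : p = p' :=
  eq_of_mem_whitney hp.1 hp'.1 hx hx'

theorem notMem_descendants_of_mem_children (hd : 1 ≤ d) (hf₁ : IsTest f₁) (hf₂ : IsTest f₂)
    (hp : p ∈ children f₁ f₂ q) : q ∉ descendants f₁ f₂ p := by
  intro h
  have h1 := measure_mono (μ := volume)
    ((cube_subset_of_mem_descendants h).trans (hp.1.1.cube_subset hd))
  exact absurd h1 (not_le.2 (volume_stoppingSet_lt hd hf₁ hf₂))

theorem add_tsum_descendants_le (hd : 1 ≤ d) (hf₁ : IsTest f₁) (hf₂ : IsTest f₂)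
    (h : DyadicIndex d → ℝ≥0∞) (q : DyadicIndex d) :
    h q + ∑' p : children f₁ f₂ q, ∑' r : descendants f₁ f₂ p.1, h r.1 ≤
      ∑' r : descendants f₁ f₂ q, h r.1 := by
  classical
  set g : descendants f₁ f₂ q → ℝ≥0∞ := fun r =>
    if r = ⟨q, self_mem_descendants⟩ then 0 else h r.1 with hg
  set φ : (Σ p : children f₁ f₂ q, descendants f₁ f₂ p.1) → descendants f₁ f₂ q :=
    fun s => ⟨s.2.1, descendants_subset s.1.2 s.2.2⟩
  have hφ : Function.Injective φ := by
    rintro ⟨⟨p, hp⟩, ⟨r, hr⟩⟩ ⟨⟨p', hp'⟩, ⟨r', hr'⟩⟩ heq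
    obtain rfl : r = r' := congrArg Subtype.val heq
    obtain ⟨x, hx⟩ := r.nonempty_cube
    obtain rfl : p = p' := eq_of_mem_children hp hp' (cube_subset_of_mem_descendants hr hx)
      (cube_subset_of_mem_descendants hr' hx)
    rfl
  rw [ENNReal.tsum_eq_add_tsum_ite (f := fun r : descendants f₁ f₂ q => h r.1)
    ⟨q, self_mem_descendants⟩]
  refine add_le_add_right ?_ _
  refine le_trans (ENNReal.tsum_sigma'
    (fun s : (Σ p : children f₁ f₂ q, descendants f₁ f₂ p.1) => h s.2.1)).ge ?_
  refine (le_trans (le_of_eq (tsum_congr ?_))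
    (ENNReal.tsum_comp_le_tsum_of_injective hφ g)).trans_eq (tsum_congr fun y => ?_)
  swap
  · simp only [hg]
    congr
  rintro ⟨⟨p, hp⟩, ⟨r, hr⟩⟩
  have hne : r ≠ q := by
    rintro rfl
    exact notMem_descendants_of_mem_children hd hf₁ hf₂ hp hr
  simp [hg, φ, hne]

/-- Iterating a recursive inequality: a quantity dominated by its values at the stopping cubes plus
an error is dominated by the sum of all errors, because the total measure of the cubes is halved
at each step. -/
theorem le_tsum_descendants (hd : 1 ≤ d) (hf₁ : IsTest f₁) (hf₂ : IsTest f₂)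
    {V h : DyadicIndex d → ℝ≥0∞} {M : ℝ≥0∞} (hM : M ≠ ∞)
    (hV : ∀ q, V q ≤ h q + ∑' p : children f₁ f₂ q, V p.1)
    (hVM : ∀ q, V q ≤ M * volume q.cube) (q : DyadicIndex d) :
    V q ≤ ∑' r : descendants f₁ f₂ q, h r.1 := by
  have key : ∀ (n : ℕ) (q : DyadicIndex d),
      V q ≤ (∑' r : descendants f₁ f₂ q, h r.1) + M * volume q.cube * 2⁻¹ ^ n := by
    intro n
    induction n with
    | zero =>
      intro q
      rw [pow_zero, mul_one]
      exact (hVM q).trans le_add_self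
    | succ n ih =>
      intro q
      calc V q ≤ h q + ∑' p : children f₁ f₂ q, V p.1 := hV q
        _ ≤ h q + ∑' p : children f₁ f₂ q, ((∑' r : descendants f₁ f₂ p.1, h r.1) +
              M * volume p.1.cube * 2⁻¹ ^ n) := by
            gcongr with p
            exact ih p.1
        _ = (h q + ∑' p : children f₁ f₂ q, ∑' r : descendants f₁ f₂ p.1, h r.1) +
              M * (∑' p : children f₁ f₂ q, volume p.1.cube) * 2⁻¹ ^ n := by
            rw [ENNReal.tsum_add, ENNReal.tsum_mul_right, ENNReal.tsum_mul_left, add_assoc]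
        _ ≤ (∑' r : descendants f₁ f₂ q, h r.1) + M * (volume q.cube / 2) * 2⁻¹ ^ n := by
            gcongr
            · exact add_tsum_descendants_le hd hf₁ hf₂ h q
            · exact tsum_volume_children_le hd hf₁ hf₂
        _ = _ := by
            rw [div_eq_mul_inv, pow_succ]
            ring
  have hlim : Filter.Tendsto (fun n : ℕ => (∑' r : descendants f₁ f₂ q, h r.1) +
      M * volume q.cube * 2⁻¹ ^ n) Filter.atTop
      (nhds ((∑' r : descendants f₁ f₂ q, h r.1) + M * volume q.cube * 0)) :=
    tendsto_const_nhds.add (ENNReal.Tendsto.const_mul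
      (ENNReal.tendsto_pow_atTop_nhds_zero_of_lt_one (by simp))
      (Or.inr (ENNReal.mul_ne_top hM q.volume_cube_ne_top)))
  rw [mul_zero, add_zero] at hlim
  exact ge_of_tendsto' hlim fun n => key n q

/-- The part of the cube not covered by its stopping cubes. -/
def core (f₁ f₂ : RSpace d → ℂ) (q : DyadicIndex d) : Set (RSpace d) :=
  q.cube \ ⋃ p ∈ children f₁ f₂ q, p.cube

theorem measurableSet_core (q : DyadicIndex d) : MeasurableSet (core f₁ f₂ q) :=
  q.measurableSet_cube.diff
    (MeasurableSet.biUnion (Set.to_countable _) fun p _ => p.measurableSet_cube)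

theorem half_volume_le_core (hd : 1 ≤ d) (hf₁ : IsTest f₁) (hf₂ : IsTest f₂)
    (q : DyadicIndex d) : volume q.cube / 2 ≤ volume (core f₁ f₂ q) := by
  have h1 : volume (⋃ p ∈ children f₁ f₂ q, p.cube) ≤ volume q.cube / 2 :=
    (measure_mono (biUnion_children_subset hd)).trans (volume_stoppingSet_le hd hf₁ hf₂)
  calc volume q.cube / 2 = volume q.cube - volume q.cube / 2 :=
        (ENNReal.sub_half q.volume_cube_ne_top).symm
    _ ≤ volume q.cube - volume (⋃ p ∈ children f₁ f₂ q, p.cube) := tsub_le_tsub_left h1 _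
    _ ≤ _ := le_measure_sdiff

theorem descendants_trichotomy {q₀ : DyadicIndex d} (hq : q ∈ descendants f₁ f₂ q₀)
    (hr : r ∈ descendants f₁ f₂ q₀) :
    r ∈ descendants f₁ f₂ q ∨ q ∈ descendants f₁ f₂ r ∨ Disjoint q.cube r.cube := by
  induction hq with
  | refl => exact Or.inl hr
  | @tail a b _ hab ih =>
    rcases ih with h | h | h
    · rcases Relation.ReflTransGen.cases_head h with rfl | ⟨p, hp, hpr⟩
      · exact Or.inr (Or.inl (Relation.ReflTransGen.single hab))
      · by_cases hbp : b = p
        · subst hbp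
          exact Or.inl hpr
        · refine Or.inr (Or.inr ?_)
          exact (disjoint_of_mem_whitney hab.1 hp.1 hbp).mono_right
            (cube_subset_of_mem_descendants hpr)
    · exact Or.inr (Or.inl (Relation.ReflTransGen.tail h hab))
    · exact Or.inr (Or.inr (h.mono_left hab.2))

theorem disjoint_core_of_mem_descendants (hr : r ∈ descendants f₁ f₂ q) (hne : q ≠ r) :
    Disjoint (core f₁ f₂ q) (core f₁ f₂ r) := by
  rcases Relation.ReflTransGen.cases_head hr with h | ⟨p, hp, hpr⟩
  · exact absurd h hne
  · rw [Set.disjoint_left]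
    rintro x ⟨-, hx⟩ ⟨hx', -⟩
    exact hx (Set.mem_iUnion₂.2 ⟨p, hp, cube_subset_of_mem_descendants hpr hx'⟩)

theorem disjoint_core {q₀ : DyadicIndex d} (hq : q ∈ descendants f₁ f₂ q₀)
    (hr : r ∈ descendants f₁ f₂ q₀) (hne : q ≠ r) :
    Disjoint (core f₁ f₂ q) (core f₁ f₂ r) := by
  rcases descendants_trichotomy hq hr with h | h | h
  · exact disjoint_core_of_mem_descendants h hne
  · exact (disjoint_core_of_mem_descendants h hne.symm).symm
  · exact h.mono Set.sdiff_subset Set.sdiff_subset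

theorem tsum_volume_descendants_le (hd : 1 ≤ d) (hf₁ : IsTest f₁) (hf₂ : IsTest f₂)
    (q : DyadicIndex d) :
    ∑' r : descendants f₁ f₂ q, volume r.1.cube ≤ 2 * volume q.cube := by
  calc ∑' r : descendants f₁ f₂ q, volume r.1.cube
      ≤ ∑' r : descendants f₁ f₂ q, 2 * volume (core f₁ f₂ r.1) :=
        ENNReal.tsum_le_tsum fun r => by
          have h := half_volume_le_core hd hf₁ hf₂ r.1
          rwa [ENNReal.div_le_iff (by simp) (by simp), mul_comm] at h
    _ = 2 * volume (⋃ r : descendants f₁ f₂ q, core f₁ f₂ r.1) := by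
        rw [ENNReal.tsum_mul_left, measure_iUnion (fun r r' h => disjoint_core r.2 r'.2
          fun h' => h (Subtype.ext h')) fun r => measurableSet_core r.1]
    _ ≤ _ := by
        gcongr
        exact Set.iUnion_subset fun r =>
          Set.sdiff_subset.trans (cube_subset_of_mem_descendants r.2)

theorem sparseTerm_le {a b : ℝ} (ha0 : 0 ≤ a) (hb0 : 0 ≤ b)
    (ha : ∀ᵐ x, ‖f₁ x‖ ≤ a) (hb : ∀ᵐ x, ‖f₂ x‖ ≤ b) (q : DyadicIndex d) :
    sparseTerm f₁ f₂ q ≤ a * b * (32 * d + 1) ^ d * volume.real q.cube := by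
  have hm : ∀ {f : RSpace d → ℂ} {a : ℝ}, 0 ≤ a → (∀ᵐ x, ‖f x‖ ≤ a) →
      (mass f q).toReal ≤ a * volume.real q.hat := by
    intro f a ha0 ha
    refine ENNReal.toReal_le_of_le_ofReal (by positivity) ?_
    rw [ENNReal.ofReal_mul ha0, ofReal_measureReal q.isBounded_hat.measure_lt_top.ne,
      ← setLIntegral_const]
    refine lintegral_mono_ae (ae_restrict_of_ae ?_)
    filter_upwards [ha] with x hx
    rw [← ofReal_norm]
    exact ENNReal.ofReal_le_ofReal hx
  have h0 : 0 < volume.real q.hat := by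
    rw [measureReal_hat]
    have := q.side_pos
    positivity
  rw [sparseTerm, div_le_iff₀ h0]
  calc (mass f₁ q).toReal * (mass f₂ q).toReal
      ≤ (a * volume.real q.hat) * (b * volume.real q.hat) := by
        gcongr
        · exact hm ha0 ha
        · exact hm hb0 hb
    _ = _ := by
        nth_rw 1 [measureReal_hat]
        rw [measureReal_cube]
        ring

theorem summable_sparseTerm (hd : 1 ≤ d) (hf₁ : IsTest f₁) (hf₂ : IsTest f₂)
    (q : DyadicIndex d) :
    Summable fun r : descendants f₁ f₂ q => sparseTerm f₁ f₂ r.1 := by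
  obtain ⟨a, ha0, ha⟩ := exists_bound hf₁
  obtain ⟨b, hb0, hb⟩ := exists_bound hf₂
  have hfin : ∑' r : descendants f₁ f₂ q, volume r.1.cube ≠ ∞ :=
    ne_top_of_le_ne_top (ENNReal.mul_ne_top (by simp) q.volume_cube_ne_top)
      (tsum_volume_descendants_le hd hf₁ hf₂ q)
  exact Summable.of_nonneg_of_le (fun r => sparseTerm_nonneg)
    (fun r => sparseTerm_le ha0 hb0 ha hb r.1)
    ((ENNReal.summable_toReal hfin).mul_left _)

/-- Sparse domination of the form by the enlarged stopping cubes. -/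
theorem norm_bilin_le_tsum (hd : 1 ≤ d) {T : L2Space d →L[ℂ] L2Space d}
    {K : RSpace d → RSpace d → ℂ} {c : ℝ} {ω : ℝ → ℝ} (hT : IsDiniCZO T K c ω)
    (hf₁ : IsTest f₁) (hf₂ : IsTest f₂) (hs₁ : Function.support f₁ ⊆ q.cube)
    (hs₂ : Function.support f₂ ⊆ q.cube) :
    ‖bilin T f₁ f₂‖ ≤ stepConst d * (‖T‖ + c * ∫ t in Set.Ioc (0 : ℝ) 1, ω t / t) *
      ∑' r : descendants f₁ f₂ q, sparseTerm f₁ f₂ r.1 := by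
  obtain ⟨M, hM, hVM⟩ := exists_localForm_le T hf₁ hf₂
  have h1 := le_localForm (f₁ := f₁) (f₂ := f₂) T q.measurableSet_cube le_rfl q.measurableSet_hat
    le_rfl
  rw [Set.indicator_eq_self.2 hs₁, Set.indicator_eq_self.2 (hs₂.trans (cube_subset_hat q))] at h1
  have h2 := h1.trans (le_tsum_descendants hd hf₁ hf₂ hM
    (fun q => localForm_le_add_tsum hd hT hf₁ hf₂) hVM q)
  have hC : 0 ≤ stepConst d * (‖T‖ + c * ∫ t in Set.Ioc (0 : ℝ) 1, ω t / t) := by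
    have := hT.const_nonneg hd
    have := hT.modulus.dini_nonneg
    unfold stepConst
    positivity
  rw [← ENNReal.ofReal_tsum_of_nonneg (fun r => mul_nonneg hC sparseTerm_nonneg)
    ((summable_sparseTerm hd hf₁ hf₂ q).mul_left _), tsum_mul_left] at h2
  exact norm_le_of_enorm_le
    (mul_nonneg hC (tsum_nonneg fun r => sparseTerm_nonneg)) h2

theorem isSparse_hat (hd : 1 ≤ d) (hf₁ : IsTest f₁) (hf₂ : IsTest f₂) (q : DyadicIndex d) {η : ℝ}
    (hη : η ≤ (2 * (32 * d + 1 : ℝ) ^ d)⁻¹) : IsSparse volume η (hat '' descendants f₁ f₂ q) := by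
  -- A cube is determined by its enlargement, so the disjoint parts can be indexed by the latter.
  have hinv : ∀ r : DyadicIndex d, Function.invFun hat r.hat = r :=
    Function.leftInverse_invFun (hat_injective hd)
  refine ⟨?_, fun X => core f₁ f₂ (Function.invFun hat X), ?_, ?_⟩
  · rintro _ ⟨r, -, rfl⟩
    exact r.measurableSet_hat
  · rintro _ ⟨r, -, rfl⟩
    beta_reduce
    rw [hinv]
    refine ⟨measurableSet_core r, Set.sdiff_subset.trans (cube_subset_hat r), ?_⟩
    refine le_trans ?_ (half_volume_le_core hd hf₁ hf₂ r)
    have hs := r.side_pos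
    rw [volume_hat, volume_cube, ← ENNReal.ofReal_mul' (by positivity), ← ENNReal.ofReal_ofNat 2,
      ← ENNReal.ofReal_div_of_pos (by norm_num)]
    refine ENNReal.ofReal_le_ofReal ?_
    calc η * ((32 * d + 1) ^ d * r.side ^ d)
        ≤ (2 * (32 * d + 1 : ℝ) ^ d)⁻¹ * ((32 * d + 1) ^ d * r.side ^ d) := by gcongr
      _ = _ := by field_simp
  · rintro _ ⟨r, hr, rfl⟩ _ ⟨r', hr', rfl⟩ hne
    beta_reduce
    rw [hinv, hinv]
    exact disjoint_core hr hr' fun h => hne (h ▸ rfl)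

/-- The sparse term in terms of averages, for nonnegative functions. -/
theorem average_mul_average_eq {f₁ f₂ : RSpace d → ℝ} (hf₁ : IsTest fun x => (f₁ x : ℂ))
    (hf₂ : IsTest fun x => (f₂ x : ℂ)) (h₁ : ∀ x, 0 ≤ f₁ x) (h₂ : ∀ x, 0 ≤ f₂ x)
    (q : DyadicIndex d) :
    (⨍ x in q.hat, f₁ x) * (⨍ x in q.hat, f₂ x) * volume.real q.hat =
      sparseTerm (fun x => (f₁ x : ℂ)) (fun x => (f₂ x : ℂ)) q := by
  have hm : ∀ {f : RSpace d → ℝ}, IsTest (fun x => (f x : ℂ)) → (∀ x, 0 ≤ f x) →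
      (mass (fun x => (f x : ℂ)) q).toReal = ∫ x in q.hat, f x := by
    intro f hf h
    have hm : AEStronglyMeasurable f volume := by
      simpa using Complex.continuous_re.comp_aestronglyMeasurable hf.memLp_top.1
    rw [integral_eq_lintegral_of_nonneg_ae (Filter.Eventually.of_forall h) hm.restrict, mass]
    congr 1
    refine lintegral_congr fun x => ?_
    rw [← ofReal_norm, Complex.norm_real, Real.norm_of_nonneg (h x)]
  have h0 : volume.real q.hat ≠ 0 := by
    rw [measureReal_hat]
    have := q.side_pos
    positivity
  rw [setAverage_eq, setAverage_eq, sparseTerm, hm hf₁ h₁, hm hf₂ h₂, smul_eq_mul, smul_eq_mul]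
  field_simp

end DyadicIndex

theorem theoremA (d : ℕ) (hd : 1 ≤ d) :
    ∃ η₀ : ℝ, 0 < η₀ ∧ η₀ < 1 ∧ ∀ η : ℝ, 0 < η → η < η₀ →
      -- the implicit constant, a function of the operator norm, the kernel constant and
      -- the Dini integral
      ∃ C : ℝ → ℝ → ℝ → ℝ,
        ∀ (Q₀ : Set (RSpace d)) (hQ₀ : IsDyadicCube Q₀) (f₁ f₂ : RSpace d → ℝ)
          (hf₁ : MemLp f₁ ∞ volume) (hf₂ : MemLp f₂ ∞ volume)
          (hs₁ : Function.support f₁ ⊆ Q₀) (hs₂ : Function.support f₂ ⊆ Q₀),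
          (∀ x, 0 ≤ f₁ x) → (∀ x, 0 ≤ f₂ x) →
          ∃ S : Set (Set (RSpace d)),
            (∀ Q ∈ S, IsCube Q) ∧
            IsSparse volume η S ∧
            Summable (fun Q : S => (⨍ x in (Q : Set (RSpace d)), f₁ x) *
              (⨍ x in (Q : Set (RSpace d)), f₂ x) * volume.real (Q : Set (RSpace d))) ∧
            ∀ (T : L2Space d →L[ℂ] L2Space d) (K : RSpace d → RSpace d → ℂ)
              (c : ℝ) (ω : ℝ → ℝ), IsDiniCZO T K c ω →
              ‖∫ x, T (toL2 hQ₀ hf₁ hs₁) x * (f₂ x : ℂ)‖ ≤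
                C ‖T‖ c (∫ t in Set.Ioc (0 : ℝ) 1, ω t / t) *
                  ∑' Q : S, (⨍ x in (Q : Set (RSpace d)), f₁ x) *
                    (⨍ x in (Q : Set (RSpace d)), f₂ x) * volume.real (Q : Set (RSpace d)) := by
  -- Half of each cube survives the stopping cubes, and `q.hat` is `(32 d + 1) ^ d` times as large.
  have hlam : (1 : ℝ) ≤ (32 * d + 1) ^ d := one_le_pow₀ (by linarith [Nat.cast_nonneg (α := ℝ) d])
  refine ⟨(2 * (32 * d + 1) ^ d)⁻¹, by positivity, inv_lt_one_of_one_lt₀ (by linarith),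
    fun η _ hη => ⟨fun N c I => DyadicIndex.stepConst d * (N + c * I), ?_⟩⟩
  intro Q₀ hQ₀ f₁ f₂ hf₁ hf₂ hs₁ hs₂ h₁ h₂
  obtain ⟨k, m, hkm⟩ := id hQ₀
  set q : DyadicIndex d := (k, m) with hq
  have hQq : Q₀ = q.cube := by rw [hkm, DyadicIndex.cube_eq]
  have hsupp : ∀ {f : RSpace d → ℝ}, Function.support f ⊆ Q₀ →
      Function.support (fun x => (f x : ℂ)) ⊆ q.cube := by
    intro f hf x hx
    rw [← hQq]
    exact hf (by simpa using hx)
  have t₁ : IsTest fun x => (f₁ x : ℂ) :=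
    IsTest.of_support_subset hf₁.ofReal q.isBounded_cube (hsupp hs₁)
  have t₂ : IsTest fun x => (f₂ x : ℂ) :=
    IsTest.of_support_subset hf₂.ofReal q.isBounded_cube (hsupp hs₂)
  set D := DyadicIndex.descendants (fun x => (f₁ x : ℂ)) (fun x => (f₂ x : ℂ)) q with hD
  have hterm := DyadicIndex.average_mul_average_eq t₁ t₂ h₁ h₂
  have hinj := DyadicIndex.hat_injective hd
  refine ⟨DyadicIndex.hat '' D, ?_, DyadicIndex.isSparse_hat hd t₁ t₂ q hη.le, ?_, ?_⟩
  · rintro _ ⟨r, -, rfl⟩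
    exact r.isCube_hat
  · rw [← (Equiv.Set.image DyadicIndex.hat D hinj).summable_iff]
    refine (DyadicIndex.summable_sparseTerm hd t₁ t₂ q).congr fun r => ?_
    exact (hterm r.1).symm
  · intro T K c ω hT
    rw [tsum_image (fun Q : Set (RSpace d) => (⨍ x in Q, f₁ x) * (⨍ x in Q, f₂ x) *
      volume.real Q) hinj.injOn, tsum_congr fun r : D => hterm r.1]
    have h := DyadicIndex.norm_bilin_le_tsum hd hT t₁ t₂ (hsupp hs₁) (hsupp hs₂)
    rwa [bilin_eq T (t₁.memLp 2)] at h
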